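/- **Conventions.** For $m\ge 0$ the Schwarzschild--anti-de Sitter metric of mass $m$ is $\overline g_m=\frac{1}{1+s^2-2ms^{-1}}\,ds\otimes ds+s^2g_{\mathbb S^2}$ on $\{s\ge 2m\}\subset\mathbb R^3$, $s=|x|$. Let $K\subset\mathbb R^3$ be a bounded open set with smooth boundary and $M=\mathbb R^3\setminus\overline K$ with a Riemannian metric $g$, smooth up to the boundary $\partial M=\partial K$ (so $g$ extends to a smooth metric $\hat g$ on $\mathbb R^3$). $(M,g)$ is a *compact perturbation of Schwarzschild--AdS of mass $m$* if $g=\overline g_m$ outside some compact set containing $K$, and $\partial M$ is connected, has constant mean curvature $H_g\equiv 2$ with respect to the normal pointing into $M$, and is outermost: there is no closed embedded two-sided surface with $H_g\equiv 2$ in the interior of $M$. A Borel set $\Omega\subset\mathbb R^3$ of finite perimeter with $K\subset\Omega$ has volume $\mathscr L^3_g(\Omega)=\operatorname{vol}_g(\Omega\cap M)$ and area $\mathcal H^2_g(\partial^*\Omega)$, i.e. its perimeter $\sup\{\int_\Omega \operatorname{div}_{\hat g}X\,d\mathrm{vol}_{\hat g} : X\in C^1_c(\mathbb R^3;\mathbb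 R^3),\ |X|_{\hat g}\le 1\}$, which does not depend on the extension $\hat g$. Such an $\Omega$ is *isoperimetric* if its area is the infimum $A_g(\mathscr L^3_g(\Omega))$ of the areas of all such sets of the same volume. For $A$ large, $\mathcal B_g(A)$ is the centered coordinate ball $\{s\le R\}$ (containing the horizon region $K$), with $\{s\geq R\}$ in the unperturbed region, whose boundary has $g$-area $A$. **Theorem.** For every $m>0$ there are $r_0>0$ and a smooth positive function $\varphi$ on $[r_0,\infty)$ such that the rotationally symmetric metric $g=dr\otimes dr+\varphi(r)^2g_{\mathbb S^2}$ on $M=(r_0,\infty)\times\mathbb S^2$ has the following properties: 1. $(M,g)$ (identified with the complement of a closed set in $\mathbb R^3$ by a map $(r,\theta)\mapsto\sigma(r)\theta$, which extends to $r=r_0$ and maps $\{r_0\}\times\mathbb S^2$ onto the boundary) is a compact perturbation of Schwarzschild--AdS of mass $m$; in particular $\{r_0\}\times\mathbb S^2$ is an outermost surface of constant mean curvature $H_g\equiv 2$. 2. $(M,g)$ does not satisfy $R_g\ge -6$ everywhere: $R_g(x)<-6$ for some $x\in M$. 3. There is $A_0$ such that for every $A\ge A_0$ the ball $\mathcal B_g(A)$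 exists and is not isoperimetric in $(M,g)$. -/

import Mathlib

open MeasureTheory Metric Set
open scoped ContDiff ENNReal

noncomputable section

namespace AdS

/-- The space `ℝ³`, with its Cartesian coordinates `x 0, x 1, x 2`; the coordinate `s` of the
hyperbolic and Schwarzschild-anti-de Sitter metrics is `‖x‖`. -/
abbrev E3 : Type := EuclideanSpace ℝ (Fin 3)

/-- The partial derivative `∂ᵢ F` of a function on `ℝ³`. -/
def pd (i : Fin 3) (F : E3 → ℝ) (x : E3) : ℝ := fderiv ℝ F x (EuclideanSpace.single i 1)

/-- A smooth Riemannian metric on `ℝ³`, given by its coefficient matrix `(g_ij)`.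
A Riemannian metric on the complement of an open set `K` with smooth boundary (smooth up to the
boundary) is represented by a smooth extension to `ℝ³`; nothing below depends on its values
inside `K`. -/
structure RMetric where
  coeff : E3 → Matrix (Fin 3) (Fin 3) ℝ
  smooth : ∀ i j, ContDiff ℝ ∞ (fun x => coeff x i j)
  posDef : ∀ x, (coeff x).PosDef

namespace RMetric

variable (g : RMetric)

/-- The scalar product `g_x(v, w)`. -/
def ip (x v w : E3) : ℝ := ∑ i, ∑ j, g.coeff x i j * v i * w j

/-- The coefficients `g^{ij}` of the inverse metric. -/
def inv (x : E3) : Matrix (Fin 3) (Fin 3) ℝ := (g.coeff x)⁻¹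

/-- The volume density `√(det g)`. -/
def dens (x : E3) : ℝ := √(g.coeff x).det

/-- The Riemannian volume measure of `g`. -/
def vol : Measure E3 := volume.withDensity (fun x => ENNReal.ofReal (g.dens x))

/-- The divergence `div_g X = (det g)^{-1/2} ∑ᵢ ∂ᵢ((det g)^{1/2} Xⁱ)`. -/
def div (X : E3 → E3) (x : E3) : ℝ :=
  (g.dens x)⁻¹ * ∑ i, pd i (fun y => g.dens y * X y i) x

/-- The Christoffel symbols `Γᵏᵢⱼ` of the Levi-Civita connection of `g`. -/
def christoffel (k i j : Fin 3) (x : E3) : ℝ :=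
  (1 / 2) * ∑ l, g.inv x k l *
    (pd i (fun y => g.coeff y j l) x + pd j (fun y => g.coeff y i l) x
      - pd l (fun y => g.coeff y i j) x)

/-- The Ricci tensor
`R_ij = ∂ₖ Γᵏᵢⱼ - ∂ⱼ Γᵏᵢₖ + Γᵏₖₗ Γˡᵢⱼ - Γᵏⱼₗ Γˡᵢₖ` (summed over repeated indices). -/
def ricci (i j : Fin 3) (x : E3) : ℝ :=
  ∑ k, (pd k (g.christoffel k i j) x - pd j (g.christoffel k i k) x
    + ∑ l, (g.christoffel k k l x * g.christoffel l i j x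
      - g.christoffel k j l x * g.christoffel l i k x))

/-- The scalar curvature `R_g`. -/
def scal (x : E3) : ℝ := ∑ i, ∑ j, g.inv x i j * g.ricci i j x

/-- The `g`-gradient of a function. -/
def grad (f : E3 → ℝ) (x : E3) : E3 := WithLp.toLp 2 fun k => ∑ l, g.inv x k l * pd l f x

/-- The unit normal `∇f / |∇f|_g` of the level sets of `f`. -/
def unitNormal (f : E3 → ℝ) (x : E3) : E3 :=
  (√(g.ip x (g.grad f x) (g.grad f x)))⁻¹ • g.grad f x

/-- The mean curvature, with respect to the unit normal `∇f / |∇f|_g`, of the level set of `f`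
through `x` (the sum of the principal curvatures; the round sphere of radius `r` in Euclidean
space has mean curvature `2 / r` with respect to its outward normal). -/
def meanCurv (f : E3 → ℝ) (x : E3) : ℝ := g.div (g.unitNormal f) x

end RMetric

/-- `f` is a regular local defining function on the open set `U` for the embedded surface `S`. -/
structure LocallyDefines (f : E3 → ℝ) (U S : Set E3) : Prop where
  isOpen : IsOpen U
  smooth : ContDiffOn ℝ ∞ f U
  regular : ∀ x ∈ U, fderiv ℝ f x ≠ 0
  zero_iff : ∀ x ∈ U, x ∈ S ↔ f x = 0

/-- `S` is a smooth embedded surface, two-sided with (continuous) `g`-unit normal field `ν`, whose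
mean curvature with respect to `ν` is constant equal to `c`. -/
def IsCMCSurface (g : RMetric) (S : Set E3) (ν : E3 → E3) (c : ℝ) : Prop :=
  ∀ p ∈ S, ∃ (U : Set E3) (f : E3 → ℝ), p ∈ U ∧ LocallyDefines f U S ∧
    ∀ x ∈ S ∩ U, ν x = g.unitNormal f x ∧ g.meanCurv f x = c

/-- The open set `K` has smooth boundary, and its boundary has constant mean curvature `c`
with respect to the unit normal pointing out of `K`. -/
def HasCMCBoundary (g : RMetric) (K : Set E3) (c : ℝ) : Prop :=
  ∀ p ∈ frontier K, ∃ (U : Set E3) (f : E3 → ℝ), p ∈ U ∧ LocallyDefines f U (frontier K) ∧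
    (∀ x ∈ U, x ∈ K ↔ f x < 0) ∧ ∀ x ∈ frontier K ∩ U, g.meanCurv f x = c

/-- The boundary of `K` is outermost: the interior `ℝ³ \ closure K` of the exterior region contains
no closed (compact without boundary) embedded two-sided surface with mean curvature `≡ 2`. -/
def IsOutermost (g : RMetric) (K : Set E3) : Prop :=
  ∀ (S : Set E3) (ν : E3 → E3), IsCompact S → S.Nonempty → S ⊆ (closure K)ᶜ →
    ¬ IsCMCSurface g S ν 2

/-- The coefficients in Cartesian coordinates of the Schwarzschild-anti-de Sitter metric
`(1 + s² - 2 m / s)⁻¹ ds² + s² g_{S²}` of mass `m`, where `s = ‖x‖`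
(so that `ds = ∑ (xᵢ / s) dxᵢ` and `s² g_{S²} = ∑ dxᵢ² - ds²`). It lives on `s ≥ 2 m`. -/
def schwarzschildAdS (m : ℝ) (x : E3) : Matrix (Fin 3) (Fin 3) ℝ :=
  Matrix.of fun i j =>
    (1 + ‖x‖ ^ 2 - 2 * m / ‖x‖)⁻¹ * ((x i / ‖x‖) * (x j / ‖x‖))
      + ((if i = j then 1 else 0) - (x i / ‖x‖) * (x j / ‖x‖))

/-- `(M, g)`, with `M = ℝ³ \ closure K`, is a compact perturbation of Schwarzschild-anti-de Sitter
of mass `m`. -/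
structure IsCompactPerturbation (m : ℝ) (K : Set E3) (g : RMetric) : Prop where
  isOpen : IsOpen K
  isBounded : Bornology.IsBounded K
  /-- `g` is the Schwarzschild-anti-de Sitter metric outside a compact set `K' ⊇ K`. -/
  eq_outside : ∃ K' : Set E3, IsCompact K' ∧ K ⊆ K' ∧
    ∀ x ∉ K', 2 * m ≤ ‖x‖ ∧ g.coeff x = schwarzschildAdS m x
  connected_boundary : IsConnected (frontier K)
  cmc_boundary : HasCMCBoundary g K 2
  outermost : IsOutermost g K

/-- The map `(r, θ) ↦ σ(r) θ`. -/
def polarMap (σ : ℝ → ℝ) (p : ℝ × E3) : E3 := σ p.1 • p.2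

/-- `(ℝ³ \ K, g)` is the warped product `[r₀, ∞) × S²` with metric `dr² + φ(r)² g_{S²}`: for some
smooth `σ`, the map `(r, θ) ↦ σ(r) θ` is a bijection from `[r₀, ∞) × S²` onto `ℝ³ \ K`, carrying
`{r₀} × S²` to the boundary, and pulls `g` back to `dr² + φ(r)² g_{S²}` (vectors `τ` orthogonal
to `θ` are the tangent vectors of `S²` at `θ`). -/
def IsWarpedProduct (r₀ : ℝ) (φ : ℝ → ℝ) (K : Set E3) (g : RMetric) : Prop :=
  ∃ σ : ℝ → ℝ, ContDiff ℝ ∞ σ ∧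
    BijOn (polarMap σ) (Ici r₀ ×ˢ sphere (0 : E3) 1) Kᶜ ∧
    polarMap σ '' ({r₀} ×ˢ sphere (0 : E3) 1) = frontier K ∧
    ∀ r ∈ Ici r₀, ∀ θ ∈ sphere (0 : E3) 1, ∀ (a : ℝ) (τ : E3), inner ℝ θ τ = 0 →
      g.ip (polarMap σ (r, θ)) (fderiv ℝ (polarMap σ) (r, θ) (a, τ))
        (fderiv ℝ (polarMap σ) (r, θ) (a, τ)) = a ^ 2 + φ r ^ 2 * ‖τ‖ ^ 2

/-- The `g`-perimeter of `Ω ⊆ ℝ³`: the total variation of the indicator function of `Ω`, i.e. the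
supremum of `∫_Ω div_g X` over compactly supported `C¹` vector fields `X` with `|X|_g ≤ 1`.
This is the two-dimensional `g`-area of the reduced boundary of `Ω`. If `Ω` contains
the open set `K`, it only depends on `g` on `ℝ³ \ K`. -/
def perimeter (g : RMetric) (Ω : Set E3) : ℝ≥0∞ :=
  ⨆ (X : E3 → E3) (_ : ContDiff ℝ 1 X ∧ HasCompactSupport X ∧ ∀ x, g.ip x (X x) (X x) ≤ 1),
    ENNReal.ofReal (∫ x in Ω, g.div X x ∂g.vol)

/-- Borel sets of finite perimeter in `ℝ³` that contain the horizon region `K`. -/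
structure IsAdmissible (K : Set E3) (g : RMetric) (Ω : Set E3) : Prop where
  measurable : MeasurableSet Ω
  contains : K ⊆ Ω
  finite : perimeter g Ω ≠ ⊤

/-- The `g`-volume of the part of `Ω` in the exterior region. -/
def extVolume (K : Set E3) (g : RMetric) (Ω : Set E3) : ℝ≥0∞ := g.vol (Ω \ K)

/-- The isoperimetric profile `A_g(V)`. -/
def profile (K : Set E3) (g : RMetric) (V : ℝ≥0∞) : ℝ≥0∞ :=
  ⨅ (Ω : Set E3) (_ : IsAdmissible K g Ω ∧ extVolume K g Ω = V), perimeter g Ω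

/-- `Ω` is an isoperimetric region of `(ℝ³ \ closure K, g)`. -/
def IsIsoperimetric (K : Set E3) (g : RMetric) (Ω : Set E3) : Prop :=
  IsAdmissible K g Ω ∧ perimeter g Ω = profile K g (extVolume K g Ω)

/-- `B` is the centered coordinate ball `{s ≤ R}` of boundary area `A`, where the boundary
`{s = R}` and everything beyond it lie in the unperturbed region. -/
def IsCenteredBall (m : ℝ) (K : Set E3) (g : RMetric) (A : ℝ) (B : Set E3) : Prop :=
  ∃ R : ℝ, 0 < R ∧ B = closedBall (0 : E3) R ∧
    (∀ x : E3, R ≤ ‖x‖ → x ∉ K ∧ 2 * m ≤ ‖x‖ ∧ g.coeff x = schwarzschildAdS m x) ∧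
    perimeter g B = ENNReal.ofReal A

end AdS

end

noncomputable section

namespace AdS

open Filter Topology

/-! The metric is `F(s²) ds² + s² g_{S²}` on all of `ℝ³`, with horizon region the unit ball. Between
`s = 1` and a large radius `√q₁` the radial coefficient is `F(q) = q⁻⁴`, after which it passes to
the Schwarzschild-AdS value within `q₁ ≤ q ≤ q₁ + 1`. A centered sphere has area `4πs²` whatever `F`
is, and mean curvature `2 / (√F s)`. Since `F(1) = 1` and `F(q) < 1/q` for `q > 1`, the unit sphere
has mean curvature `2` and all larger spheres have more, so a farthest-point comparison
(`meanCurv_ge_of_touching`) makes the unit sphere outermost. The steep coefficient `q⁻⁴` forces very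
negative scalar curvature (`scal_lt`).

Large centered balls lose to an off-center competitor because their volume is too small. The part of
the perturbed region with coefficient `q⁻⁴` has volume bounded independently of `q₁`, while the
hyperbolic ball of area radius `√q₁` has volume at least `q₁`. For `q₁` large, a centered ball of
area `4πR²` therefore holds less volume than a hyperbolic ball of area `4π(R² - 2)`
(`exists_volume_deficit`). Far out in the end `g` is close to the hyperbolic metric, with volume
density at least the hyperbolic one. The union of the horizon region and a distant, nearly
hyperbolic ball then encloses the same volume. Its area is at most `4π` for the horizon plus the
hyperbolic area `4π(R² - 2)` up to an error below `4π`, so less than `4πR²` in total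
(`exists_competitor`).

Perimeters are estimated from their definition as suprema of fluxes. The divergence theorem is only
needed on Euclidean balls, since in hyperboloid coordinates hyperbolic balls are affine images of
Euclidean balls. -/

lemma norm_sq_eq_sum (x : E3) : ‖x‖ ^ 2 = x 0 ^ 2 + x 1 ^ 2 + x 2 ^ 2 := by
  rw [EuclideanSpace.real_norm_sq_eq, Fin.sum_univ_three]

lemma inner_eq_sum (x y : E3) : inner ℝ x y = x 0 * y 0 + x 1 * y 1 + x 2 * y 2 := by
  simp [PiLp.inner_apply, Fin.sum_univ_three]; ring

/-- The Euclidean divergence of a vector field on `ℝ³`. -/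
def eDiv (Y : E3 → E3) (x : E3) : ℝ := ∑ i, pd i (fun y => Y y i) x

/-! ### Rotationally symmetric metrics: inverse, volume density, divergence. -/

/-- The data of a rotationally symmetric metric `|dx|² + a(|x|²) (x · dx)²` on `ℝ³`. -/
structure RadialProfile where
  a : ℝ → ℝ
  smooth : ContDiff ℝ ∞ a
  pos : ∀ q, 0 ≤ q → 0 < 1 + a q * q

namespace RadialProfile

variable (P : RadialProfile)

/-- The radial coefficient `g(x/|x|, x/|x|)`, as a function of `q = |x|²`. -/
def F (q : ℝ) : ℝ := 1 + P.a q * q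

lemma F_pos (x : E3) : 0 < P.F (‖x‖ ^ 2) := P.pos _ (by positivity)

lemma F_smooth : ContDiff ℝ ∞ P.F := contDiff_const.add (P.smooth.mul contDiff_id)

lemma F_norm_smooth : ContDiff ℝ ∞ (fun x : E3 => P.F (‖x‖ ^ 2)) :=
  P.F_smooth.comp (contDiff_norm_sq ℝ)

lemma sqrt_F_smooth : ContDiff ℝ ∞ (fun x : E3 => √(P.F (‖x‖ ^ 2))) :=
  P.F_norm_smooth.sqrt fun x => (P.F_pos x).ne'

lemma coord_smooth (i : Fin 3) : ContDiff ℝ ∞ (fun x : E3 => x i) :=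
  (EuclideanSpace.proj (𝕜 := ℝ) i).contDiff

/-- The coefficients `δ_ij + a(|x|²) x_i x_j`. -/
def coeff (x : E3) : Matrix (Fin 3) (Fin 3) ℝ :=
  Matrix.of fun i j => (if i = j then 1 else 0) + P.a (‖x‖ ^ 2) * (x i * x j)

lemma quadratic_pos (x v : E3) (hv : v ≠ 0) :
    0 < ‖v‖ ^ 2 + P.a (‖x‖ ^ 2) * inner ℝ x v ^ 2 := by
  have hF := P.F_pos x
  unfold F at hF
  have hv' : 0 < ‖v‖ ^ 2 := by positivity
  have hcs : inner ℝ x v ^ 2 ≤ ‖x‖ ^ 2 * ‖v‖ ^ 2 := by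
    rw [← mul_pow, sq_le_sq, abs_of_nonneg (a := ‖x‖ * ‖v‖) (by positivity)]
    exact abs_real_inner_le_norm x v
  rcases le_total 0 (P.a (‖x‖ ^ 2)) with h | h
  · nlinarith [mul_nonneg h (sq_nonneg (inner ℝ x v))]
  · nlinarith [mul_le_mul_of_nonpos_left hcs h, mul_pos hv' hF]

/-- The metric `|dx|² + a(|x|²) (x · dx)²`. -/
def metric : RMetric where
  coeff := P.coeff
  smooth i j := by
    simp only [coeff, Matrix.of_apply]
    exact contDiff_const.add ((P.smooth.comp (contDiff_norm_sq ℝ)).mul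
      ((coord_smooth i).mul (coord_smooth j)))
  posDef x := by
    rw [Matrix.posDef_iff_dotProduct_mulVec]
    refine ⟨?_, fun v hv => ?_⟩
    · ext i j
      simp only [coeff, Matrix.conjTranspose_apply, Matrix.of_apply, star_trivial, eq_comm (a := j)]
      ring
    · have h := P.quadratic_pos x (WithLp.toLp 2 v) (by
        intro h; apply hv; simpa using h)
      rw [norm_sq_eq_sum (WithLp.toLp 2 v), inner_eq_sum] at h
      simp only [coeff, dotProduct, Matrix.mulVec, Matrix.of_apply, Fin.sum_univ_three,
        Pi.star_apply, star_trivial, Fin.isValue]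
      refine lt_of_lt_of_eq h ?_
      simp
      ring

lemma ip_eq (x v w : E3) :
    P.metric.ip x v w = inner ℝ v w + P.a (‖x‖ ^ 2) * (inner ℝ x v * inner ℝ x w) := by
  simp only [RMetric.ip, metric, coeff, Matrix.of_apply, Fin.sum_univ_three, inner_eq_sum]
  simp
  ring

lemma dens_eq (x : E3) : P.metric.dens x = √(P.F (‖x‖ ^ 2)) := by
  unfold RMetric.dens F
  congr 1
  simp only [metric, coeff, Matrix.det_fin_three, Matrix.of_apply]
  generalize P.a (‖x‖ ^ 2) = b
  rw [norm_sq_eq_sum]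
  simp
  ring

lemma dens_pos (x : E3) : 0 < P.metric.dens x := by
  rw [dens_eq]; exact Real.sqrt_pos.2 (P.F_pos x)

lemma dens_smooth : ContDiff ℝ ∞ P.metric.dens := by
  have : P.metric.dens = fun x => √(P.F (‖x‖ ^ 2)) := funext P.dens_eq
  rw [this]; exact P.sqrt_F_smooth

lemma inv_eq (x : E3) (i j : Fin 3) :
    P.metric.inv x i j
      = (if i = j then 1 else 0) - P.a (‖x‖ ^ 2) / P.F (‖x‖ ^ 2) * (x i * x j) := by
  have hF := (P.F_pos x).ne'
  have : P.metric.inv x = Matrix.of fun i j =>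
      (if i = j then 1 else 0) - P.a (‖x‖ ^ 2) / P.F (‖x‖ ^ 2) * (x i * x j) := by
    apply Matrix.inv_eq_right_inv
    have hq := norm_sq_eq_sum x
    have hF2 : P.F (‖x‖ ^ 2) = 1 + P.a (‖x‖ ^ 2) * (x 0 ^ 2 + x 1 ^ 2 + x 2 ^ 2) := by
      rw [← hq, F]
    generalize P.F (‖x‖ ^ 2) = G at *
    ext k l
    simp only [metric, coeff, Matrix.mul_apply, Matrix.of_apply, Fin.sum_univ_three]
    generalize P.a (‖x‖ ^ 2) = b at *
    have key : ∀ u : ℝ, b * u - b / G * u - b * (x 0 ^ 2 + x 1 ^ 2 + x 2 ^ 2) * (b / G) * u = 0 := by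
      intro u; field_simp; rw [hF2]; ring
    fin_cases k <;> fin_cases l <;> simp
    · linear_combination key (x 0 * x 0)
    · linear_combination key (x 0 * x 1)
    · linear_combination key (x 0 * x 2)
    · linear_combination key (x 1 * x 0)
    · linear_combination key (x 1 * x 1)
    · linear_combination key (x 1 * x 2)
    · linear_combination key (x 2 * x 0)
    · linear_combination key (x 2 * x 1)
    · linear_combination key (x 2 * x 2)
  rw [this, Matrix.of_apply]

lemma div_eq (X : E3 → E3) (x : E3) :
    P.metric.div X x = (P.metric.dens x)⁻¹ * eDiv (fun y => P.metric.dens y • X y) x := by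
  simp [RMetric.div, eDiv]

lemma vol_apply {Ω : Set E3} (hΩ : MeasurableSet Ω) :
    P.metric.vol Ω = ∫⁻ x in Ω, ENNReal.ofReal (P.metric.dens x) :=
  withDensity_apply _ hΩ

/-- The density in the volume measure cancels its inverse in `div_g`, so every flux in the
definition of the perimeter becomes a Euclidean one. -/
lemma setIntegral_div {Ω : Set E3} (hΩ : MeasurableSet Ω) (X : E3 → E3) :
    ∫ x in Ω, P.metric.div X x ∂P.metric.vol
      = ∫ x in Ω, eDiv (fun y => P.metric.dens y • X y) x := by
  have hm : Measurable P.metric.dens := P.dens_smooth.continuous.measurable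
  rw [RMetric.vol, restrict_withDensity hΩ,
    integral_withDensity_eq_integral_toReal_smul (by fun_prop) (by simp)]
  refine integral_congr_ae (ae_of_all _ fun x => ?_)
  have := P.dens_pos x
  simp only [div_eq, ENNReal.toReal_ofReal this.le, smul_eq_mul]
  field_simp

end RadialProfile

/-! ### The Euclidean divergence theorem on balls, as an inequality. -/

lemma eDiv_eq_sum_fderiv {W : E3 → E3} {x : E3} (hW : DifferentiableAt ℝ W x) :
    eDiv W x = ∑ i, (fderiv ℝ W x (EuclideanSpace.single i 1)) i := by
  refine Finset.sum_congr rfl fun i _ => ?_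
  have h : HasFDerivAt (fun y => W y i)
      ((EuclideanSpace.proj (𝕜 := ℝ) i : E3 →L[ℝ] ℝ).comp (fderiv ℝ W x)) x :=
    (EuclideanSpace.proj (𝕜 := ℝ) i : E3 →L[ℝ] ℝ).hasFDerivAt.comp x hW.hasFDerivAt
  simp [pd, h.fderiv]

lemma continuous_eDiv {W : E3 → E3} (hW : ContDiff ℝ 1 W) : Continuous (eDiv W) := by
  have : eDiv W = fun x => ∑ i, (fderiv ℝ W x (EuclideanSpace.single i 1)) i :=
    funext fun x => eDiv_eq_sum_fderiv (hW.differentiable one_ne_zero x)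
  rw [this]
  have h := hW.continuous_fderiv one_ne_zero
  fun_prop

lemma sum_coord_smul_single (v : E3) : ∑ i, v i • (EuclideanSpace.single i (1 : ℝ) : E3) = v := by
  ext j
  fin_cases j <;> simp [Fin.sum_univ_three]

lemma eDiv_smul {ψ : E3 → ℝ} {W : E3 → E3} {x : E3} (hψ : DifferentiableAt ℝ ψ x)
    (hW : DifferentiableAt ℝ W x) :
    eDiv (fun y => ψ y • W y) x = ψ x * eDiv W x + fderiv ℝ ψ x (W x) := by
  rw [eDiv_eq_sum_fderiv (hψ.fun_smul hW), eDiv_eq_sum_fderiv hW, fderiv_fun_smul hψ hW]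
  conv_rhs => rw [← sum_coord_smul_single (W x)]
  simp [Finset.sum_add_distrib, Finset.mul_sum, mul_comm]

lemma eDiv_sub_smul_id {W : E3 → E3} {x : E3} (hW : DifferentiableAt ℝ W x) (c : ℝ) :
    eDiv (fun y => W y - c • y) x = eDiv W x - 3 * c := by
  have h : HasFDerivAt (fun y : E3 => W y - c • y)
      (fderiv ℝ W x - c • ContinuousLinearMap.id ℝ E3) x :=
    hW.hasFDerivAt.sub ((hasFDerivAt_id x).const_smul c)
  rw [eDiv_eq_sum_fderiv h.differentiableAt, eDiv_eq_sum_fderiv hW, h.fderiv]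
  simp [Finset.sum_sub_distrib]

lemma integral_eDiv_eq_zero {W : E3 → E3} (hW : ContDiff ℝ 1 W) (hc : HasCompactSupport W) :
    ∫ x, eDiv W x = 0 := by
  have hWi : ∀ i, ContDiff ℝ 1 (fun y => W y i) := fun i =>
    ((RadialProfile.coord_smooth i).of_le (mod_cast le_top)).comp hW
  have hci : ∀ i, HasCompactSupport (fun y => W y i) := fun i =>
    hc.comp_left (g := fun v : E3 => v i) rfl
  have hcont : ∀ i, Continuous (fun x => fderiv ℝ (fun y => W y i) x (EuclideanSpace.single i 1)) :=
    fun i => ((hWi i).continuous_fderiv one_ne_zero).clm_apply continuous_const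
  have hint : ∀ i, Integrable (fun x => fderiv ℝ (fun y => W y i) x (EuclideanSpace.single i 1)) :=
    fun i => (hcont i).integrable_of_hasCompactSupport ((hci i).fderiv_apply (𝕜 := ℝ) _)
  unfold eDiv pd
  rw [integral_finsetSum _ fun i _ => hint i]
  refine Finset.sum_eq_zero fun i _ => ?_
  have := integral_mul_fderiv_eq_neg_fderiv_mul_of_integrable (μ := (volume : Measure E3))
    (f := fun _ : E3 => (1 : ℝ)) (g := fun y => W y i) (v := EuclideanSpace.single i 1)
    (by simp) (by simpa using hint i)
    (by simpa using (hWi i).continuous.integrable_of_hasCompactSupport (hci i))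
    (fun x _ => by fun_prop) (fun x _ => (hWi i).differentiable one_ne_zero x)
  simpa using this

lemma setIntegral_closedBall_eq_ball (f : E3 → ℝ) (S : ℝ) :
    ∫ x in closedBall (0 : E3) S, f x = ∫ x in ball (0 : E3) S, f x := by
  apply setIntegral_congr_set
  exact (ae_eq_of_subset_of_measure_ge ball_subset_closedBall
    (Measure.addHaar_closedBall_eq_addHaar_ball _ _ _).le measurableSet_ball.nullMeasurableSet
    measure_closedBall_lt_top.ne).symm

lemma volume_real_closedBall {S : ℝ} (hS : 0 ≤ S) :
    (volume : Measure E3).real (closedBall 0 S) = 4 / 3 * Real.pi * S ^ 3 := by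
  rw [Measure.real, EuclideanSpace.volume_closedBall_fin_three, ← ENNReal.ofReal_pow hS,
    ENNReal.toReal_mul, ENNReal.toReal_ofReal (by positivity),
    ENNReal.toReal_ofReal (by positivity)]
  ring

/-- The divergence of `ψₙ W` integrates to zero for radial cut-offs `ψₙ` increasing to the indicator
of the open ball. Their gradients point inward and concentrate near the sphere, where `W` points
inward too, so the gradient term is nonnegative. -/
lemma setIntegral_eDiv_nonpos {W : E3 → E3} (hW : ContDiff ℝ 1 W) {S : ℝ} (hS : 0 < S)
    (hneg : ∀ y : E3, ‖y‖ = S → inner ℝ (W y) y < 0) :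
    ∫ y in closedBall (0 : E3) S, eDiv W y ≤ 0 := by
  -- the flux is inward in a shell below the sphere
  obtain ⟨δ, hδ, hshell⟩ : ∃ δ > 0, ∀ y : E3, S ^ 2 - δ ≤ ‖y‖ ^ 2 → ‖y‖ ^ 2 ≤ S ^ 2 →
      inner ℝ (W y) y ≤ 0 := by
    have hcW := hW.continuous
    have hK : IsCompact (closedBall (0 : E3) S ∩ {y | 0 ≤ inner ℝ (W y) y}) :=
      (isCompact_closedBall _ _).inter_right (isClosed_le (by fun_prop) (by fun_prop))
    rcases (closedBall (0 : E3) S ∩ {y | 0 ≤ inner ℝ (W y) y}).eq_empty_or_nonempty with h | h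
    · refine ⟨1, one_pos, fun y _ hy => ?_⟩
      by_contra! hlt
      have : y ∈ (∅ : Set E3) := h ▸ ⟨by
        rw [mem_closedBall_zero_iff]; exact le_of_sq_le_sq hy hS.le, hlt.le⟩
      exact this
    -- The outermost point of the ball at which the flux is not inward lies strictly inside, by the
    -- strict sign on the sphere; `δ` is half of the resulting gap in squared radius.
    · obtain ⟨p, hp, hmax⟩ := hK.exists_isMaxOn h (f := fun y => ‖y‖ ^ 2) (by fun_prop)
      have hpS : ‖p‖ < S := by
        refine lt_of_le_of_ne (mem_closedBall_zero_iff.1 hp.1) fun h => ?_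
        exact absurd hp.2 (not_le.2 (hneg p h))
      have hpS2 : ‖p‖ ^ 2 < S ^ 2 := by gcongr
      refine ⟨(S ^ 2 - ‖p‖ ^ 2) / 2, by linarith, fun y h1 h2 => ?_⟩
      by_contra! hlt
      have : ‖y‖ ^ 2 ≤ ‖p‖ ^ 2 := hmax ⟨by
        rw [mem_closedBall_zero_iff]; exact le_of_sq_le_sq h2 hS.le, hlt.le⟩
      linarith
  let ψ : ℕ → E3 → ℝ := fun n y => Real.smoothTransition (n * (S ^ 2 - ‖y‖ ^ 2))
  have hψs : ∀ n, ContDiff ℝ 1 (ψ n) := fun n =>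
    Real.smoothTransition.contDiff.comp (contDiff_const.mul
      (contDiff_const.sub (contDiff_norm_sq ℝ)))
  have hψ0 : ∀ n y, y ∉ ball (0 : E3) S → ψ n y = 0 := fun n y hy => by
    rw [mem_ball_zero_iff, not_lt] at hy
    apply Real.smoothTransition.zero_of_nonpos
    have : S ^ 2 ≤ ‖y‖ ^ 2 := by gcongr
    exact mul_nonpos_of_nonneg_of_nonpos n.cast_nonneg (by linarith)
  have hcE := continuous_eDiv hW
  have hint : Integrable ((closedBall (0 : E3) S).indicator fun y => ‖eDiv W y‖) :=
    (hcE.norm.continuousOn.integrableOn_compact (isCompact_closedBall _ _)).integrable_indicator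
      measurableSet_closedBall
  have hbound : ∀ n y, ‖ψ n y * eDiv W y‖ ≤ (closedBall (0 : E3) S).indicator
      (fun y => ‖eDiv W y‖) y := fun n y => by
    by_cases hy : y ∈ ball (0 : E3) S
    · rw [indicator_of_mem (ball_subset_closedBall hy), norm_mul, Real.norm_eq_abs,
        abs_of_nonneg (Real.smoothTransition.nonneg _)]
      exact mul_le_of_le_one_left (norm_nonneg _) (Real.smoothTransition.le_one _)
    · rw [hψ0 n y hy, zero_mul, norm_zero]
      exact indicator_nonneg (fun _ _ => norm_nonneg _) _
  have hlim : Tendsto (fun n => ∫ y, ψ n y * eDiv W y) atTop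
      (𝓝 (∫ y, (ball (0 : E3) S).indicator (eDiv W) y)) := by
    refine tendsto_integral_of_dominated_convergence _
      (fun n => ((hψs n).continuous.mul hcE).aestronglyMeasurable) hint
      (fun n => ae_of_all _ (hbound n)) (ae_of_all _ fun y => ?_)
    by_cases hy : y ∈ ball (0 : E3) S
    · rw [indicator_of_mem hy]
      rw [mem_ball_zero_iff] at hy
      have hpos : 0 < S ^ 2 - ‖y‖ ^ 2 := by
        have : ‖y‖ ^ 2 < S ^ 2 := by gcongr
        linarith
      obtain ⟨N, hN⟩ := exists_nat_gt (1 / (S ^ 2 - ‖y‖ ^ 2))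
      refine tendsto_const_nhds.congr' ?_
      filter_upwards [eventually_ge_atTop N] with n hn
      have hn' : (N : ℝ) ≤ n := by exact_mod_cast hn
      have : ψ n y = 1 := Real.smoothTransition.one_of_one_le (by
        rw [div_lt_iff₀ hpos] at hN; nlinarith)
      rw [this, one_mul]
    · rw [indicator_of_notMem hy]
      refine tendsto_const_nhds.congr fun n => ?_
      rw [hψ0 n y hy, zero_mul]
  rw [setIntegral_closedBall_eq_ball, ← integral_indicator measurableSet_ball]
  refine le_of_tendsto hlim ?_
  obtain ⟨N, hN⟩ := exists_nat_gt (1 / δ)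
  filter_upwards [eventually_ge_atTop N, eventually_ge_atTop 1] with n hn hn1
  have hn' : (N : ℝ) ≤ n := by exact_mod_cast hn
  have hn1' : (1 : ℝ) ≤ n := by exact_mod_cast hn1
  have hcs : HasCompactSupport (fun y => ψ n y • W y) := by
    refine HasCompactSupport.intro (isCompact_closedBall (0 : E3) S) fun y hy => ?_
    rw [hψ0 n y fun h => hy (ball_subset_closedBall h), zero_smul]
  have hC1 : ContDiff ℝ 1 (fun y => ψ n y • W y) := (hψs n).smul hW
  have hzero := integral_eDiv_eq_zero hC1 hcs
  have hψint : Integrable fun y => ψ n y * eDiv W y :=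
    hint.mono' ((hψs n).continuous.mul hcE).aestronglyMeasurable (ae_of_all _ (hbound n))
  -- For `n > 1/δ` the derivative of the cut-off vanishes outside the shell, so the gradient term
  -- only has to be signed inside it.
  have hle : ∀ y, ψ n y * eDiv W y ≤ eDiv (fun y => ψ n y • W y) y := fun y => by
    rw [eDiv_smul ((hψs n).differentiable one_ne_zero y) (hW.differentiable one_ne_zero y)]
    have hq : HasFDerivAt (fun y : E3 => (n : ℝ) * (S ^ 2 - ‖y‖ ^ 2))
        ((n : ℝ) • -(2 • innerSL ℝ y : E3 →L[ℝ] ℝ)) y :=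
      ((hasStrictFDerivAt_norm_sq y).hasFDerivAt.const_sub (S ^ 2)).const_mul (n : ℝ)
    have hst : HasDerivAt Real.smoothTransition
        (deriv Real.smoothTransition (n * (S ^ 2 - ‖y‖ ^ 2))) (n * (S ^ 2 - ‖y‖ ^ 2)) :=
      ((Real.smoothTransition.contDiff (n := 1)).differentiable one_ne_zero _).hasDerivAt
    have hf := hst.comp_hasFDerivAt y hq
    have hf' : fderiv ℝ (ψ n) y (W y) = deriv Real.smoothTransition (n * (S ^ 2 - ‖y‖ ^ 2))
        * (n * (-(2 * inner ℝ (W y) y))) := by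
      rw [show ψ n = Real.smoothTransition ∘ fun y : E3 => (n : ℝ) * (S ^ 2 - ‖y‖ ^ 2) from rfl,
        hf.fderiv]
      simp [real_inner_comm]
    rw [hf']
    have hmono : 0 ≤ deriv Real.smoothTransition (n * (S ^ 2 - ‖y‖ ^ 2)) :=
      Real.smoothTransition.monotone.deriv_nonneg
    rcases lt_or_ge (S ^ 2) (‖y‖ ^ 2) with h | h
    · have : deriv Real.smoothTransition (n * (S ^ 2 - ‖y‖ ^ 2)) = 0 := by
        have : Real.smoothTransition =ᶠ[𝓝 ((n : ℝ) * (S ^ 2 - ‖y‖ ^ 2))] fun _ => 0 := by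
          filter_upwards [Iio_mem_nhds (show (n : ℝ) * (S ^ 2 - ‖y‖ ^ 2) < 0 by nlinarith)]
            with u hu
          exact Real.smoothTransition.zero_of_nonpos (le_of_lt hu)
        rw [this.deriv_eq]; simp
      rw [this]; simp
    rcases lt_or_ge (‖y‖ ^ 2) (S ^ 2 - δ) with h2 | h2
    · have : deriv Real.smoothTransition (n * (S ^ 2 - ‖y‖ ^ 2)) = 0 := by
        have : Real.smoothTransition =ᶠ[𝓝 ((n : ℝ) * (S ^ 2 - ‖y‖ ^ 2))] fun _ => 1 := by
          rw [div_lt_iff₀ hδ] at hN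
          filter_upwards [Ioi_mem_nhds (show 1 < (n : ℝ) * (S ^ 2 - ‖y‖ ^ 2) by nlinarith)]
            with u hu
          exact Real.smoothTransition.one_of_one_le (le_of_lt hu)
        rw [this.deriv_eq]; simp
      rw [this]; simp
    have := hshell y h2 h
    have h3 : 0 ≤ (n : ℝ) * (-(2 * inner ℝ (W y) y)) :=
      mul_nonneg n.cast_nonneg (by linarith)
    have := mul_nonneg hmono h3
    linarith
  calc _ ≤ ∫ y, eDiv (fun y => ψ n y • W y) y := by
        refine integral_mono hψint ?_ hle
        refine (continuous_eDiv hC1).integrable_of_hasCompactSupport ?_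
        refine HasCompactSupport.intro (isCompact_closedBall (0 : E3) S) fun y hy => ?_
        have : (fun y => ψ n y • W y) =ᶠ[𝓝 y] fun _ => 0 := by
          filter_upwards [isClosed_closedBall.isOpen_compl.mem_nhds hy] with z hz
          rw [hψ0 n z fun h => hz (ball_subset_closedBall h), zero_smul]
        rw [eDiv_eq_sum_fderiv (hC1.differentiable one_ne_zero y), this.fderiv_eq]
        simp
    _ = 0 := hzero

/-- The divergence theorem on a Euclidean ball, as an upper bound for the flux. -/
lemma setIntegral_eDiv_closedBall_le {Z : E3 → E3} (hZ : ContDiff ℝ 1 Z) {S k : ℝ} (hS : 0 < S)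
    (hk : ∀ y : E3, ‖y‖ = S → inner ℝ (Z y) y ≤ k * S) :
    ∫ y in closedBall (0 : E3) S, eDiv Z y ≤ 4 * Real.pi * S ^ 2 * k := by
  have key : ∀ ε > 0, ∫ y in closedBall (0 : E3) S, eDiv Z y
      ≤ 4 * Real.pi * S ^ 2 * k + 4 * Real.pi * S ^ 3 * ε := by
    intro ε hε
    -- Subtracting a multiple of the position field, whose divergence is constant, reduces to inward
    -- flux; `ε` makes the sign strict.
    have hW : ContDiff ℝ 1 (fun y => Z y - (k / S + ε) • y) :=
      hZ.sub (contDiff_id.const_smul (k / S + ε))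
    have h := setIntegral_eDiv_nonpos hW hS (fun y hy => by
      rw [inner_sub_left, real_inner_smul_left, real_inner_self_eq_norm_sq, hy]
      have := hk y hy
      have h1 : (k / S + ε) * S ^ 2 = k * S + ε * S ^ 2 := by field_simp
      have h2 : 0 < ε * S ^ 2 := by positivity
      linarith)
    have heq : ∀ y, eDiv (fun y => Z y - (k / S + ε) • y) y = eDiv Z y - 3 * (k / S + ε) :=
      fun y => eDiv_sub_smul_id (hZ.differentiable one_ne_zero y) _
    simp only [heq] at h
    rw [integral_sub ((continuous_eDiv hZ).continuousOn.integrableOn_compact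
      (isCompact_closedBall _ _)) (continuous_const.continuousOn.integrableOn_compact
        (isCompact_closedBall _ _)),
      setIntegral_const, volume_real_closedBall hS.le, smul_eq_mul] at h
    have : 4 / 3 * Real.pi * S ^ 3 * (3 * (k / S + ε))
        = 4 * Real.pi * S ^ 2 * k + 4 * Real.pi * S ^ 3 * ε := by field_simp
    linarith
  refine le_of_forall_pos_le_add fun η hη => ?_
  have hp : 0 < 4 * Real.pi * S ^ 3 := by positivity
  have := key (η / (4 * Real.pi * S ^ 3)) (by positivity)
  rwa [mul_div_cancel₀ _ hp.ne'] at this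

lemma eDiv_neg (Y : E3 → E3) (x : E3) : eDiv (fun y => -Y y) x = -eDiv Y x := by
  simp [eDiv, pd, fderiv_fun_neg]

/-! ### Perimeter of centered balls. -/

namespace RadialProfile

variable (P : RadialProfile)

lemma contDiff_dens_smul {X : E3 → E3} (hX : ContDiff ℝ 1 X) :
    ContDiff ℝ 1 (fun y => P.metric.dens y • X y) :=
  (P.dens_smooth.of_le (mod_cast le_top)).smul hX

/-- This is Cauchy-Schwarz for `g`: the radial covector `y` has squared dual norm `|y|² / F`. -/
lemma F_mul_inner_sq_le (y X : E3) :
    P.F (‖y‖ ^ 2) * inner ℝ X y ^ 2 ≤ ‖y‖ ^ 2 * P.metric.ip y X X := by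
  rw [ip_eq, real_inner_self_eq_norm_sq, real_inner_comm X y, F]
  have hcs : inner ℝ X y ^ 2 ≤ ‖X‖ ^ 2 * ‖y‖ ^ 2 := by
    rw [← mul_pow, sq_le_sq, abs_of_nonneg (a := ‖X‖ * ‖y‖) (by positivity)]
    exact abs_real_inner_le_norm X y
  nlinarith

lemma inner_dens_smul_le {y X : E3} (hX : P.metric.ip y X X ≤ 1) :
    inner ℝ (P.metric.dens y • X) y ≤ ‖y‖ := by
  have h := P.F_mul_inner_sq_le y X
  rw [dens_eq, real_inner_smul_left]
  refine le_of_sq_le_sq ?_ (norm_nonneg y)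
  rw [mul_pow, Real.sq_sqrt (P.F_pos y).le]
  nlinarith [sq_nonneg ‖y‖]

lemma setIntegral_closedBall_div_le {X : E3 → E3} (hX : ContDiff ℝ 1 X)
    (h1 : ∀ x, P.metric.ip x (X x) (X x) ≤ 1) {R : ℝ} (hR : 0 < R) :
    ∫ x in closedBall (0 : E3) R, eDiv (fun y => P.metric.dens y • X y) x
      ≤ 4 * Real.pi * R ^ 2 := by
  have := setIntegral_eDiv_closedBall_le (P.contDiff_dens_smul hX) (k := 1) hR (fun y hy => by
    rw [one_mul, ← hy]; exact P.inner_dens_smul_le (h1 y))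
  simpa using this

/-- A cut-off function of `‖y‖` that is `1` on the sphere of radius `R` and is supported in a
compact set that does not contain the origin. -/
def shellCutoff (R : ℝ) (y : E3) : ℝ :=
  Real.smoothTransition (4 * (‖y‖ ^ 2 / R ^ 2) - 1) *
    (1 - Real.smoothTransition (‖y‖ ^ 2 / R ^ 2 - 1))

lemma shellCutoff_smooth (R : ℝ) : ContDiff ℝ 1 (shellCutoff R) := by
  have hq : ContDiff ℝ 1 (fun y : E3 => ‖y‖ ^ 2 / R ^ 2) := (contDiff_norm_sq ℝ).div_const _
  exact (Real.smoothTransition.contDiff.comp ((contDiff_const.mul hq).sub contDiff_const)).mul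
    (contDiff_const.sub (Real.smoothTransition.contDiff.comp (hq.sub contDiff_const)))

lemma shellCutoff_sq_le_one (R : ℝ) (y : E3) : shellCutoff R y ^ 2 ≤ 1 := by
  have h0 := Real.smoothTransition.nonneg (4 * (‖y‖ ^ 2 / R ^ 2) - 1)
  have h1 := Real.smoothTransition.le_one (4 * (‖y‖ ^ 2 / R ^ 2) - 1)
  have h2 := Real.smoothTransition.nonneg (‖y‖ ^ 2 / R ^ 2 - 1)
  have h3 := Real.smoothTransition.le_one (‖y‖ ^ 2 / R ^ 2 - 1)
  apply pow_le_one₀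
  · exact mul_nonneg h0 (by linarith)
  · exact mul_le_one₀ h1 (by linarith) (by linarith)

lemma ip_smul_smul (x v : E3) (c : ℝ) :
    P.metric.ip x (c • v) (c • v) = c ^ 2 * P.metric.ip x v v := by
  rw [ip_eq, ip_eq, real_inner_smul_left, real_inner_smul_right, real_inner_smul_right]
  ring

lemma ip_self_position (x : E3) : P.metric.ip x x x = ‖x‖ ^ 2 * P.F (‖x‖ ^ 2) := by
  rw [ip_eq, real_inner_self_eq_norm_sq, F]
  ring

lemma perimeter_closedBall {R : ℝ} (hR : 0 < R) :
    perimeter P.metric (closedBall (0 : E3) R) = ENNReal.ofReal (4 * Real.pi * R ^ 2) := by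
  apply le_antisymm
  · refine iSup₂_le fun X hX => ?_
    rw [P.setIntegral_div measurableSet_closedBall]
    exact ENNReal.ofReal_le_ofReal (P.setIntegral_closedBall_div_le hX.1 hX.2.2 hR)
  -- A calibration: on the sphere of radius `R` this is the outward `g`-unit radial field, and the
  -- cut-off removes the singularity at the origin.
  let X : E3 → E3 := fun y => (shellCutoff R y / (√(P.F (‖y‖ ^ 2)) * ‖y‖)) • y
  have hXs : ContDiff ℝ 1 X := by
    rw [contDiff_iff_contDiffAt]
    intro y
    rcases eq_or_ne y 0 with rfl | hy
    · have : X =ᶠ[𝓝 0] fun _ => 0 := by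
        filter_upwards [ball_mem_nhds (0 : E3) (half_pos hR)] with z hz
        rw [mem_ball_zero_iff] at hz
        have h1 : ‖z‖ ^ 2 ≤ (R / 2) ^ 2 := by gcongr
        have h2 : 4 * (‖z‖ ^ 2 / R ^ 2) - 1 ≤ 0 := by
          rw [sub_nonpos, ← mul_div_assoc, div_le_one (by positivity)]; linarith
        simp [X, shellCutoff, Real.smoothTransition.zero_of_nonpos h2]
      exact contDiffAt_const.congr_of_eventuallyEq this
    · refine ((shellCutoff_smooth R).contDiffAt.div ((P.sqrt_F_smooth.of_le
        (mod_cast le_top)).contDiffAt.mul (contDiffAt_norm ℝ hy)) ?_).smul contDiffAt_id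
      exact mul_ne_zero (Real.sqrt_ne_zero'.2 (P.F_pos y)) (norm_ne_zero_iff.2 hy)
  have hXc : HasCompactSupport X := by
    refine HasCompactSupport.intro (isCompact_closedBall (0 : E3) (2 * R)) fun z hz => ?_
    rw [mem_closedBall_zero_iff, not_le] at hz
    have h1 : (2 * R) ^ 2 ≤ ‖z‖ ^ 2 := by gcongr
    have h2 : 1 ≤ ‖z‖ ^ 2 / R ^ 2 - 1 := by
      rw [le_sub_iff_add_le, le_div_iff₀ (by positivity)]; nlinarith
    simp [X, shellCutoff, Real.smoothTransition.one_of_one_le h2]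
  have hX1 : ∀ y, P.metric.ip y (X y) (X y) ≤ 1 := fun y => by
    rcases eq_or_ne y 0 with rfl | hy
    · simp [ip_eq, X]
    have hF := P.F_pos y
    have hn : 0 < ‖y‖ := norm_pos_iff.2 hy
    refine le_of_eq_of_le ?_ (shellCutoff_sq_le_one R y)
    have hs : √(P.F (‖y‖ ^ 2)) ^ 2 = P.F (‖y‖ ^ 2) := Real.sq_sqrt hF.le
    have hs0 : 0 < √(P.F (‖y‖ ^ 2)) := Real.sqrt_pos.2 hF
    simp only [X, ip_smul_smul, ip_self_position]
    field_simp
    rw [hs]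
  refine le_trans ?_ (le_iSup₂ (α := ℝ≥0∞) X ⟨hXs, hXc, hX1⟩)
  rw [P.setIntegral_div measurableSet_closedBall]
  apply ENNReal.ofReal_le_ofReal
  -- The upper flux bound, applied to the opposite field, gives the lower bound for the flux of `X`.
  have h := setIntegral_eDiv_closedBall_le (P.contDiff_dens_smul hXs).neg (k := -1) hR
    (fun y hy => by
      have hn : 0 < ‖y‖ := hy ▸ hR
      have hs0 : 0 < √(P.F (‖y‖ ^ 2)) := Real.sqrt_pos.2 (P.F_pos y)
      have hc : shellCutoff R y = 1 := by
        rw [shellCutoff, hy, div_self (by positivity)]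
        simp [Real.smoothTransition.one_of_one_le (show (1 : ℝ) ≤ 4 - 1 by norm_num)]
      simp only [dens_eq, X, hc, inner_neg_left, real_inner_smul_left, real_inner_self_eq_norm_sq]
      rw [← hy]
      field_simp
      exact le_rfl)
  simp only [eDiv_neg, integral_neg] at h
  linarith

end RadialProfile

/-! ### Gradients, unit normals and the mean curvature of centered spheres. -/

/-- The Euclidean gradient. -/
def eGrad (f : E3 → ℝ) (x : E3) : E3 := (InnerProductSpace.toDual ℝ E3).symm (fderiv ℝ f x)

lemma inner_eGrad (f : E3 → ℝ) (x v : E3) : inner ℝ (eGrad f x) v = fderiv ℝ f x v :=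
  InnerProductSpace.toDual_symm_apply

lemma eGrad_apply (f : E3 → ℝ) (x : E3) (l : Fin 3) : eGrad f x l = pd l f x := by
  rw [pd, ← inner_eGrad, EuclideanSpace.inner_single_right]; simp

lemma eGrad_contDiffAt {f : E3 → ℝ} {x : E3} (hf : ContDiffAt ℝ ∞ f x) :
    ContDiffAt ℝ 1 (eGrad f) x :=
  (InnerProductSpace.toDual ℝ E3).symm.toContinuousLinearEquiv.contDiff.contDiffAt.comp x
    (hf.fderiv_right (m := 1) (by norm_cast))

lemma eGrad_neg (f : E3 → ℝ) (x : E3) : eGrad (fun y => -f y) x = -eGrad f x := by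
  simp [eGrad, fderiv_fun_neg]

namespace RadialProfile

variable (P : RadialProfile)

lemma grad_eq (f : E3 → ℝ) (x : E3) :
    P.metric.grad f x = eGrad f x
      - (P.a (‖x‖ ^ 2) / P.F (‖x‖ ^ 2) * inner ℝ x (eGrad f x)) • x := by
  ext k
  simp only [RMetric.grad, inv_eq, ← eGrad_apply, inner_eq_sum, Fin.sum_univ_three]
  fin_cases k <;> simp <;> ring

lemma unitNormal_neg (f : E3 → ℝ) (x : E3) :
    P.metric.unitNormal (fun y => -f y) x = -P.metric.unitNormal f x := by
  have : P.metric.grad (fun y => -f y) x = (-1 : ℝ) • P.metric.grad f x := by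
    rw [grad_eq, grad_eq, eGrad_neg, inner_neg_right]; module
  rw [RMetric.unitNormal, RMetric.unitNormal, this, ip_smul_smul]
  simp

lemma meanCurv_eq (f : E3 → ℝ) (x : E3) : P.metric.meanCurv f x =
    (P.metric.dens x)⁻¹ * eDiv (fun y => P.metric.dens y • P.metric.unitNormal f y) x :=
  P.div_eq _ x

lemma meanCurv_neg (f : E3 → ℝ) (x : E3) :
    P.metric.meanCurv (fun y => -f y) x = -P.metric.meanCurv f x := by
  simp only [meanCurv_eq, unitNormal_neg, smul_neg, eDiv_neg, mul_neg]

lemma grad_eq_of_parallel {f : E3 → ℝ} {x : E3} {μ : ℝ} (h : eGrad f x = μ • x) :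
    P.metric.grad f x = (μ / P.F (‖x‖ ^ 2)) • x := by
  have hF := (P.F_pos x).ne'
  rw [grad_eq, h, real_inner_smul_right, real_inner_self_eq_norm_sq, ← sub_smul]
  congr 1
  field_simp
  rw [F]; ring

lemma ip_grad_of_parallel {f : E3 → ℝ} {x : E3} {μ : ℝ} (h : eGrad f x = μ • x) :
    P.metric.ip x (P.metric.grad f x) (P.metric.grad f x)
      = μ ^ 2 * ‖x‖ ^ 2 / P.F (‖x‖ ^ 2) := by
  have hF := (P.F_pos x).ne'
  rw [P.grad_eq_of_parallel h, ip_smul_smul, ip_self_position]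
  field_simp

/-- The radial unit normal has Euclidean length `F^{-1/2}`, which the density `F^{1/2}` cancels. The
mean curvature of a centered sphere is thus the Euclidean one divided by `√F`. -/
lemma dens_smul_unitNormal_of_parallel {f : E3 → ℝ} {x : E3} {μ : ℝ} (hx : x ≠ 0) (hμ : 0 < μ)
    (h : eGrad f x = μ • x) :
    P.metric.dens x • P.metric.unitNormal f x = ‖x‖⁻¹ • x := by
  have hF := P.F_pos x
  have hn : 0 < ‖x‖ := norm_pos_iff.2 hx
  rw [RMetric.unitNormal, P.ip_grad_of_parallel h, P.grad_eq_of_parallel h, dens_eq, smul_smul,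
    smul_smul, Real.sqrt_div' _ hF.le, ← mul_pow, Real.sqrt_sq (by positivity)]
  congr 1
  have hs : √(P.F (‖x‖ ^ 2)) ^ 2 = P.F (‖x‖ ^ 2) := Real.sq_sqrt hF.le
  have hs0 : 0 < √(P.F (‖x‖ ^ 2)) := Real.sqrt_pos.2 hF
  field_simp
  rw [hs]

lemma eDiv_inv_norm_smul {x : E3} (hx : x ≠ 0) :
    eDiv (fun y : E3 => ‖y‖⁻¹ • y) x = 2 / ‖x‖ := by
  have hn : ‖x‖ ≠ 0 := norm_ne_zero_iff.2 hx
  have hd : DifferentiableAt ℝ (fun y : E3 => ‖y‖⁻¹) x :=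
    (differentiableAt_id.norm ℝ hx).inv hn
  have hid : eDiv (fun y : E3 => y) x = 3 := by
    have := eDiv_sub_smul_id (W := fun _ => (0 : E3)) (x := x) (by fun_prop) (-1)
    simp only [neg_smul, one_smul, zero_sub, neg_neg] at this
    rw [this]; simp [eDiv, pd]
  rw [eDiv_smul hd differentiableAt_fun_id, hid]
  -- The derivative in the radial direction is read off from homogeneity along the ray through `x`.
  have h1 : HasDerivAt (fun t : ℝ => ‖x + t • x‖⁻¹) (fderiv ℝ (fun y : E3 => ‖y‖⁻¹) x x) 0 := by
    have hg : HasDerivAt (fun t : ℝ => x + t • x) x 0 := by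
      simpa using ((hasDerivAt_id (0 : ℝ)).smul_const x).const_add x
    have hd' : HasFDerivAt (fun y : E3 => ‖y‖⁻¹) (fderiv ℝ (fun y : E3 => ‖y‖⁻¹) x)
      (x + (0 : ℝ) • x) := by simpa using hd.hasFDerivAt
    exact hd'.comp_hasDerivAt 0 hg
  have h2 : HasDerivAt (fun t : ℝ => ‖x + t • x‖⁻¹) (-‖x‖⁻¹) 0 := by
    have : HasDerivAt (fun t : ℝ => (1 + t)⁻¹ * ‖x‖⁻¹) (-1 * ‖x‖⁻¹) 0 := by
      have := ((hasDerivAt_id (0 : ℝ)).const_add 1).inv (by simp)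
      simpa using this.mul_const ‖x‖⁻¹
    rw [neg_one_mul] at this
    refine this.congr_of_eventuallyEq ?_
    filter_upwards [Ioi_mem_nhds (show (-1 : ℝ) < 0 by norm_num)] with t ht
    have ht' : 0 < 1 + t := by have := mem_Ioi.1 ht; linarith
    rw [show x + t • x = (1 + t) • x by module, norm_smul, Real.norm_of_nonneg ht'.le, mul_inv]
  rw [h1.unique h2]
  field_simp
  norm_num

lemma eGrad_norm_sq_sub_const (c : ℝ) (x : E3) :
    eGrad (fun y => ‖y‖ ^ 2 - c) x = (2 : ℝ) • x := by
  apply ext_inner_right ℝ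
  intro v
  have h : HasFDerivAt (fun y : E3 => ‖y‖ ^ 2 - c) (2 • innerSL ℝ x : E3 →L[ℝ] ℝ) x :=
    (hasStrictFDerivAt_norm_sq x).hasFDerivAt.sub_const c
  rw [inner_eGrad, h.fderiv]
  simp [real_inner_smul_left]

lemma meanCurv_norm_sq_sub_const (c : ℝ) {x : E3} (hx : x ≠ 0) :
    P.metric.meanCurv (fun y => ‖y‖ ^ 2 - c) x = 2 / (√(P.F (‖x‖ ^ 2)) * ‖x‖) := by
  have h : (fun y => P.metric.dens y • P.metric.unitNormal (fun y => ‖y‖ ^ 2 - c) y)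
      =ᶠ[𝓝 x] fun y => ‖y‖⁻¹ • y := by
    filter_upwards [isOpen_ne.mem_nhds hx] with y hy
    exact P.dens_smul_unitNormal_of_parallel hy two_pos (eGrad_norm_sq_sub_const c y)
  have h' : eDiv (fun y => P.metric.dens y • P.metric.unitNormal (fun y => ‖y‖ ^ 2 - c) y) x
      = eDiv (fun y : E3 => ‖y‖⁻¹ • y) x := by
    refine Finset.sum_congr rfl fun i _ => ?_
    unfold pd
    have : (fun y => (P.metric.dens y • P.metric.unitNormal (fun y => ‖y‖ ^ 2 - c) y) i)
      =ᶠ[𝓝 x] fun y => (‖y‖⁻¹ • y) i := h.fun_comp (fun v : E3 => v i)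
    rw [this.fderiv_eq]
  rw [meanCurv_eq, h', eDiv_inv_norm_smul hx, dens_eq]
  field_simp

lemma hasCMCBoundary_unitBall (h1 : P.F 1 = 1) : HasCMCBoundary P.metric (ball 0 1) 2 := by
  rw [HasCMCBoundary, frontier_ball _ one_ne_zero]
  intro p hp
  rw [mem_sphere_zero_iff_norm] at hp
  refine ⟨{0}ᶜ, fun y => ‖y‖ ^ 2 - 1, ?_, ⟨isOpen_compl_singleton, ?_, ?_, ?_⟩, ?_, ?_⟩
  · rintro rfl; simp at hp
  · exact ((contDiff_norm_sq ℝ).sub contDiff_const).contDiffOn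
  · intro x hx h
    have := inner_eGrad (fun y => ‖y‖ ^ 2 - 1) x x
    rw [h, eGrad_norm_sq_sub_const, real_inner_smul_left, real_inner_self_eq_norm_sq] at this
    have hn : 0 < ‖x‖ := norm_pos_iff.2 hx
    simp at this
    exact hx this
  · intro x _
    rw [mem_sphere_zero_iff_norm, sub_eq_zero, pow_eq_one_iff_of_nonneg (norm_nonneg x) two_ne_zero]
  · intro x _
    rw [mem_ball_zero_iff, sub_neg, sq_lt_one_iff_abs_lt_one, abs_norm]
  · intro x hx
    have hn : ‖x‖ = 1 := mem_sphere_zero_iff_norm.1 hx.1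
    rw [P.meanCurv_norm_sq_sub_const 1 hx.2, hn]
    simp [h1]

end RadialProfile

/-! ### Level sets touching a centered sphere from inside: first and second order conditions. -/

lemma pos_of_convex_of_ne_zero {s : Set E3} (hs : Convex ℝ s) {f : E3 → ℝ} (hf : ContinuousOn f s)
    (h0 : ∀ x ∈ s, f x ≠ 0) {x y : E3} (hx : x ∈ s) (hy : y ∈ s) (hfx : 0 < f x) : 0 < f y := by
  by_contra! hle
  obtain ⟨z, hz, hz0⟩ := hs.isPreconnected.intermediate_value hy hx hf ⟨hle, hfx.le⟩
  exact h0 z hz hz0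

/-- A function without zeros outside a ball, near a boundary point of that ball, has constant sign
there. -/
lemma constant_sign_outside_ball {U : Set E3} (hU : IsOpen U) {f : E3 → ℝ}
    (hf : ContinuousOn f U) {p : E3} (hp : p ∈ U) (hp0 : p ≠ 0)
    (hne : ∀ x ∈ U, ‖p‖ < ‖x‖ → f x ≠ 0) :
    (∀ᶠ x in 𝓝 p, ‖p‖ < ‖x‖ → 0 < f x) ∨ (∀ᶠ x in 𝓝 p, ‖p‖ < ‖x‖ → f x < 0) := by
  have hpn : 0 < ‖p‖ := norm_pos_iff.2 hp0
  obtain ⟨r₀, hr₀, hrU⟩ := Metric.isOpen_iff.1 hU p hp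
  set r := min r₀ ‖p‖ with hr
  have hrpos : 0 < r := lt_min hr₀ hpn
  have hrp : r ≤ ‖p‖ := min_le_right _ _
  have hrU : ball p r ⊆ U := (ball_subset_ball (min_le_left _ _)).trans hrU
  -- the half ball
  let H : Set E3 := ball p r ∩ {x | ‖p‖ ^ 2 < inner ℝ p x}
  have hHc : Convex ℝ H := (convex_ball _ _).inter
    (convex_halfSpace_gt (innerSL ℝ p).toLinearMap.isLinear _)
  have hHout : ∀ x ∈ H, ‖p‖ < ‖x‖ := fun x hx => by
    have h1 : ‖p‖ ^ 2 < ‖p‖ * ‖x‖ := lt_of_lt_of_le hx.2 (real_inner_le_norm p x)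
    nlinarith
  have hHU : H ⊆ U := inter_subset_left.trans hrU
  let c : ℝ := r / 2 / ‖p‖
  have hc : 0 < c := by positivity
  have hcn : ‖c • p‖ = r / 2 := by
    rw [norm_smul, Real.norm_of_nonneg hc.le]; simp only [c]; field_simp
  have hcp : c * ‖p‖ ^ 2 = r / 2 * ‖p‖ := by simp only [c]; field_simp
  have hpush : ∀ x ∈ ball p (r / 3), x + c • p ∈ H := fun x hx => by
    rw [mem_ball, dist_eq_norm] at hx
    refine ⟨?_, ?_⟩
    · rw [mem_ball, dist_eq_norm, show x + c • p - p = (x - p) + c • p by abel]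
      have := norm_add_le (x - p) (c • p)
      linarith
    · have h1 : |inner ℝ p (x - p)| ≤ ‖p‖ * ‖x - p‖ := abs_real_inner_le_norm _ _
      have h2 := (abs_le.1 h1).1
      rw [inner_sub_right, real_inner_self_eq_norm_sq] at h2
      rw [mem_ofPred_eq, inner_add_right, real_inner_smul_right, real_inner_self_eq_norm_sq, hcp]
      nlinarith
  -- Moving from an outside point near `p` in the direction `p` does not decrease the norm, so the
  -- path stays off the zero set until it reaches the convex half ball.
  have hseg : ∀ x ∈ ball p (r / 3), ‖p‖ < ‖x‖ → ∀ z ∈ segment ℝ x (x + c • p),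
      z ∈ U ∧ f z ≠ 0 := fun x hx hxp z hz => by
    rw [mem_ball, dist_eq_norm] at hx
    have hx0 : 0 ≤ inner ℝ p x := by
      have h2 := (abs_le.1 (abs_real_inner_le_norm p (x - p))).1
      rw [inner_sub_right, real_inner_self_eq_norm_sq] at h2
      nlinarith
    rw [segment_eq_image'] at hz
    obtain ⟨t, ht, rfl⟩ := hz
    simp only [add_sub_cancel_left]
    have hzU : x + t • c • p ∈ U := by
      apply hrU
      rw [mem_ball, dist_eq_norm, show x + t • c • p - p = (x - p) + t • c • p by abel]
      have h1 := norm_add_le (x - p) (t • c • p)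
      have h2 : ‖t • c • p‖ ≤ r / 2 := by
        rw [norm_smul, hcn, Real.norm_of_nonneg ht.1]; nlinarith [ht.2]
      linarith
    refine ⟨hzU, hne _ hzU (hxp.trans_le ?_)⟩
    refine le_of_sq_le_sq ?_ (norm_nonneg _)
    rw [norm_add_sq_real, real_inner_smul_right, real_inner_smul_right, real_inner_comm]
    have := mul_nonneg ht.1 (mul_nonneg hc.le hx0)
    nlinarith [sq_nonneg ‖t • c • p‖]
  have hp0 : p ∈ ball p (r / 3) := mem_ball_self (by linarith)
  have hb := ball_mem_nhds p (show 0 < r / 3 by linarith)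
  have hsign : ∀ g : E3 → ℝ, (∀ x, g x = f x ∨ g x = -f x) → ContinuousOn g U →
      0 < g (p + c • p) → ∀ᶠ x in 𝓝 p, ‖p‖ < ‖x‖ → 0 < g x := by
    intro g hg hgc hpos
    have hg0 : ∀ x, f x ≠ 0 → g x ≠ 0 := fun x hx => by rcases hg x with h | h <;> simp [h, hx]
    filter_upwards [hb] with x hx hxp
    have h1 : 0 < g (x + c • p) := pos_of_convex_of_ne_zero hHc (hgc.mono hHU)
      (fun z hz => hg0 z (hne z (hHU hz) (hHout z hz))) (hpush p hp0) (hpush x hx) hpos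
    exact pos_of_convex_of_ne_zero (convex_segment x (x + c • p))
      (hgc.mono fun z hz => (hseg x hx hxp z hz).1)
      (fun z hz => hg0 z (hseg x hx hxp z hz).2) (right_mem_segment ℝ _ _)
      (left_mem_segment ℝ _ _) h1
  have hHp := hpush p hp0
  rcases (hne _ (hHU hHp) (hHout _ hHp)).lt_or_gt with h | h
  · right
    filter_upwards [hsign (fun x => -f x) (fun x => Or.inr rfl) hf.neg (by simpa using h)]
      with x hx hxp
    simpa using hx hxp
  · left
    exact hsign f (fun x => Or.inl rfl) hf h

/-- The second order necessary condition for a local minimum. -/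
lemma deriv_deriv_nonneg_of_isLocalMin {h : ℝ → ℝ} {t : ℝ} (hm : IsLocalMin h t)
    (hc : ContinuousAt h t) : 0 ≤ deriv (deriv h) t := by
  by_contra! hneg
  have hmax := isLocalMax_of_deriv_deriv_neg hneg hm.deriv_eq_zero hc
  have hconst : h =ᶠ[𝓝 t] fun _ => h t := by
    filter_upwards [hm, hmax] with s h1 h2 using le_antisymm h2 h1
  have : deriv h =ᶠ[𝓝 t] fun _ => 0 := by
    filter_upwards [hconst.eventuallyEq_nhds] with s hs
    rw [hs.deriv_eq]; simp
  rw [this.deriv_eq] at hneg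
  simp at hneg

/-- A line through `p` tangent to the sphere lies outside the ball except at `p`, so `f` has a
minimum along it there. -/
lemma fderiv_eq_zero_of_touching {f : E3 → ℝ} {p : E3} (hf : ContDiffAt ℝ ∞ f p) (hfp : f p = 0)
    (hpos : ∀ᶠ x in 𝓝 p, ‖p‖ < ‖x‖ → 0 < f x)
    {v : E3} (hv : inner ℝ p v = 0) : fderiv ℝ f p v = 0 := by
  rcases eq_or_ne v 0 with rfl | hv0
  · simp
  have hγ : HasDerivAt (fun t : ℝ => p + t • v) v 0 := by
    simpa using ((hasDerivAt_id (0 : ℝ)).smul_const v).const_add p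
  have hd : HasFDerivAt f (fderiv ℝ f p) (p + (0 : ℝ) • v) := by
    simpa using (hf.differentiableAt (by simp)).hasFDerivAt
  have hh := hd.comp_hasDerivAt 0 hγ
  have hcont : Tendsto (fun t : ℝ => p + t • v) (𝓝 0) (𝓝 p) := by
    simpa using hγ.continuousAt.tendsto
  have hmin : IsLocalMin (f ∘ fun t : ℝ => p + t • v) 0 := by
    filter_upwards [hcont.eventually hpos] with t ht
    simp only [Function.comp, zero_smul, add_zero, hfp]
    rcases eq_or_ne t 0 with rfl | ht0
    · simp [hfp]
    refine (ht ?_).le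
    refine lt_of_pow_lt_pow_left₀ 2 (norm_nonneg _) ?_
    rw [norm_add_sq_real, real_inner_smul_right, hv]
    have : 0 < ‖t • v‖ := norm_pos_iff.2 (smul_ne_zero ht0 hv0)
    nlinarith
  exact hmin.hasDerivAt_eq_zero hh

lemma fderiv_nonneg_of_touching {f : E3 → ℝ} {p : E3} (hf : ContDiffAt ℝ ∞ f p) (hfp : f p = 0)
    (hpos : ∀ᶠ x in 𝓝 p, ‖p‖ < ‖x‖ → 0 < f x)
    (hp : p ≠ 0) : 0 ≤ fderiv ℝ f p p := by
  have hγ : HasDerivAt (fun t : ℝ => p + t • p) p 0 := by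
    simpa using ((hasDerivAt_id (0 : ℝ)).smul_const p).const_add p
  have hd : HasFDerivAt f (fderiv ℝ f p) (p + (0 : ℝ) • p) := by
    simpa using (hf.differentiableAt (by simp)).hasFDerivAt
  have hh := hd.comp_hasDerivAt 0 hγ
  have hcont : Tendsto (fun t : ℝ => p + t • p) (𝓝 0) (𝓝 p) := by
    simpa using hγ.continuousAt.tendsto
  by_contra! hneg
  have hn : 0 < ‖p‖ := norm_pos_iff.2 hp
  have hsl := (hasDerivAt_iff_tendsto_slope.1 hh).mono_left
    (nhdsWithin_mono _ (show Ioi (0 : ℝ) ⊆ {0}ᶜ from fun t ht => ne_of_gt ht))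
  have h1 := hsl.eventually (gt_mem_nhds hneg)
  have h2 : ∀ᶠ t in 𝓝[>] (0 : ℝ), ‖p‖ < ‖p + t • p‖ → 0 < f (p + t • p) :=
    (hcont.eventually hpos).filter_mono nhdsWithin_le_nhds
  obtain ⟨t, ⟨h1, h2⟩, ht⟩ := ((h1.and h2).and self_mem_nhdsWithin).exists
  have ht' : (0 : ℝ) < t := ht
  have h3 : ‖p‖ < ‖p + t • p‖ := by
    rw [show p + t • p = (1 + t) • p by module, norm_smul, Real.norm_of_nonneg (by linarith)]
    nlinarith
  have h4 := h2 h3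
  simp only [slope_def_field, Function.comp, zero_smul, add_zero, hfp, sub_zero] at h1
  have := div_pos h4 ht'
  linarith

/-- Straight tangent lines would only give a nonnegative Hessian. The sharp bound, which carries the
curvature of the sphere, comes from parabolas that bend towards the ball as much as possible while
staying outside it. -/
lemma hessian_ge_of_touching {f : E3 → ℝ} {p : E3} (hf : ContDiffAt ℝ ∞ f p) (hfp : f p = 0)
    (hpos : ∀ᶠ x in 𝓝 p, ‖p‖ < ‖x‖ → 0 < f x)
    (hp : p ≠ 0) {v : E3} (hv : inner ℝ p v = 0) :
    ‖v‖ ^ 2 * (fderiv ℝ f p p / ‖p‖ ^ 2) ≤ fderiv ℝ (fderiv ℝ f) p v v := by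
  rcases eq_or_ne v 0 with rfl | hv0
  · simp
  have hn : 0 < ‖p‖ := norm_pos_iff.2 hp
  have hvn : 0 < ‖v‖ := norm_pos_iff.2 hv0
  -- For `γ(t) = p + t v + β t² p`, `|γ|² - |p|²` is at least `t² (|v|² + 2β|p|²)`; the threshold on
  -- `β` is where this vanishes. The limit at the threshold is taken afterwards.
  have key : ∀ β : ℝ, -(‖v‖ ^ 2) / (2 * ‖p‖ ^ 2) < β →
      0 ≤ fderiv ℝ (fderiv ℝ f) p v v + 2 * β * fderiv ℝ f p p := by
    intro β hβ
    let γ : ℝ → E3 := fun t => p + (t • v + (t ^ 2 * β) • p)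
    have hγ : ∀ t, HasDerivAt γ (v + (2 * t * β) • p) t := fun t => by
      have h1 : HasDerivAt (fun t : ℝ => t • v) v t := by
        simpa using (hasDerivAt_id t).smul_const v
      have h2 : HasDerivAt (fun t : ℝ => (t ^ 2 * β) • p) ((2 * t * β) • p) t := by
        simpa using ((hasDerivAt_pow 2 t).mul_const β).smul_const p
      exact (h1.add h2).const_add p
    have hγ0 : γ 0 = p := by simp [γ]
    have hcont : Tendsto γ (𝓝 0) (𝓝 p) := by
      simpa [hγ0] using (hγ 0).continuousAt.tendsto
    have hmin : IsLocalMin (f ∘ γ) 0 := by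
      filter_upwards [hcont.eventually hpos] with t ht
      simp only [Function.comp, hγ0, hfp]
      rcases eq_or_ne t 0 with rfl | ht0
      · simp [hγ0, hfp]
      refine (ht ?_).le
      refine lt_of_pow_lt_pow_left₀ 2 (norm_nonneg _) ?_
      have ht2 : 0 < t ^ 2 := by positivity
      rw [norm_add_sq_real, inner_add_right, real_inner_smul_right, real_inner_smul_right, hv,
        real_inner_self_eq_norm_sq, norm_add_sq_real, norm_smul, mul_pow, Real.norm_eq_abs, sq_abs,
        real_inner_smul_left, real_inner_smul_right, real_inner_comm, hv]
      rw [div_lt_iff₀ (by positivity)] at hβ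
      have h5 := mul_pos ht2 (show 0 < ‖v‖ ^ 2 + β * (2 * ‖p‖ ^ 2) by linarith)
      nlinarith [sq_nonneg ‖(t ^ 2 * β) • p‖]
    have hev : ∀ᶠ x in 𝓝 p, DifferentiableAt ℝ f x := by
      have := (hf.of_le (m := 1) (mod_cast le_top)).eventually (by simp)
      filter_upwards [this] with x hx using hx.differentiableAt one_ne_zero
    have hderiv : deriv (f ∘ γ) =ᶠ[𝓝 0] fun t => fderiv ℝ f (γ t) (v + (2 * t * β) • p) := by
      filter_upwards [hcont.eventually hev] with t ht
      exact (ht.hasFDerivAt.comp_hasDerivAt t (hγ t)).deriv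
    have hf2 : HasFDerivAt (fderiv ℝ f) (fderiv ℝ (fderiv ℝ f) p) (γ 0) := by
      rw [hγ0]
      exact ((hf.fderiv_right (m := 1) (by norm_cast)).differentiableAt one_ne_zero).hasFDerivAt
    have h2 := hf2.comp_hasDerivAt 0 (hγ 0)
    have h3 : HasDerivAt (fun t : ℝ => v + (2 * t * β) • p) ((2 * β) • p) 0 := by
      simpa using ((((hasDerivAt_id (0 : ℝ)).const_mul 2).mul_const β).smul_const p).const_add v
    have h4 := h2.clm_apply h3
    have h5 := deriv_deriv_nonneg_of_isLocalMin hmin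
      (ContinuousAt.comp (by rw [hγ0]; exact hf.continuousAt) (hγ 0).continuousAt)
    rw [hderiv.deriv_eq] at h5
    rw [show (fun t => fderiv ℝ f (γ t) (v + (2 * t * β) • p)) = fun t =>
      (fderiv ℝ f ∘ γ) t (v + (2 * t * β) • p) from rfl, h4.deriv] at h5
    simpa [hγ0] using h5
  have hlim : Tendsto (fun β : ℝ => fderiv ℝ (fderiv ℝ f) p v v + 2 * β * fderiv ℝ f p p)
      (𝓝[>] (-(‖v‖ ^ 2) / (2 * ‖p‖ ^ 2)))
      (𝓝 (fderiv ℝ (fderiv ℝ f) p v v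
        + 2 * (-(‖v‖ ^ 2) / (2 * ‖p‖ ^ 2)) * fderiv ℝ f p p)) := by
    refine Tendsto.mono_left (Continuous.tendsto (by fun_prop) _) nhdsWithin_le_nhds
  have h := ge_of_tendsto hlim (by filter_upwards [self_mem_nhdsWithin] with β hβ using key β hβ)
  have : 2 * (-(‖v‖ ^ 2) / (2 * ‖p‖ ^ 2)) * fderiv ℝ f p p
      = -(‖v‖ ^ 2 * (fderiv ℝ f p p / ‖p‖ ^ 2)) := by field_simp
  linarith

lemma eGrad_eq_of_touching {f : E3 → ℝ} {p : E3} (hf : ContDiffAt ℝ ∞ f p) (hfp : f p = 0)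
    (hpos : ∀ᶠ x in 𝓝 p, ‖p‖ < ‖x‖ → 0 < f x)
    (hp : p ≠ 0) : eGrad f p = (fderiv ℝ f p p / ‖p‖ ^ 2) • p := by
  have hn : ‖p‖ ^ 2 ≠ 0 := pow_ne_zero 2 (norm_ne_zero_iff.2 hp)
  apply ext_inner_right ℝ
  intro v
  set c := inner ℝ p v / ‖p‖ ^ 2 with hc
  have h1 : inner ℝ p (v - c • p) = 0 := by
    rw [inner_sub_right, real_inner_smul_right, real_inner_self_eq_norm_sq, hc]
    field_simp; ring
  have h2 := fderiv_eq_zero_of_touching hf hfp hpos h1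
  rw [map_sub, map_smul, sub_eq_zero, smul_eq_mul] at h2
  rw [inner_eGrad, h2, real_inner_smul_left, hc]
  field_simp

/-- The trace of a linear map, computed from tangential projections of the coordinate vectors. -/
lemma sum_apply_single_eq (M : E3 →L[ℝ] E3) {p : E3} (hp : p ≠ 0) :
    ∑ i, (M (EuclideanSpace.single i 1)) i
      = ∑ i, inner ℝ (EuclideanSpace.single i 1 - (p i / ‖p‖ ^ 2) • p)
          (M (EuclideanSpace.single i 1 - (p i / ‖p‖ ^ 2) • p)) + inner ℝ p (M p) / ‖p‖ ^ 2 := by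
  have hq : ‖p‖ ^ 2 ≠ 0 := pow_ne_zero 2 (norm_ne_zero_iff.2 hp)
  have hMp : inner ℝ p (M p) = ∑ i, p i * inner ℝ p (M (EuclideanSpace.single i 1)) := by
    conv_lhs => rw [← sum_coord_smul_single p, map_sum, inner_sum]
    simp only [map_smul, real_inner_smul_right, sum_coord_smul_single]
  have hMp2 : inner ℝ p (M p) = ∑ i, p i * (M p) i := by
    rw [inner_eq_sum, Fin.sum_univ_three]
  have hqs : ‖p‖ ^ 2 = ∑ i, p i ^ 2 := by rw [norm_sq_eq_sum, Fin.sum_univ_three]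
  have hterm : ∀ i, inner ℝ (EuclideanSpace.single i 1 - (p i / ‖p‖ ^ 2) • p)
      (M (EuclideanSpace.single i 1 - (p i / ‖p‖ ^ 2) • p))
      = (M (EuclideanSpace.single i 1)) i - (p i * (M p) i) / ‖p‖ ^ 2
        - (p i * inner ℝ p (M (EuclideanSpace.single i 1))) / ‖p‖ ^ 2
        + p i ^ 2 * (inner ℝ p (M p) / (‖p‖ ^ 2) ^ 2) := fun i => by
    simp only [map_sub, map_smul, inner_sub_left, inner_sub_right, real_inner_smul_left,
      real_inner_smul_right, EuclideanSpace.inner_single_left]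
    simp
    field_simp
    ring
  rw [Finset.sum_congr rfl fun i _ => hterm i, Finset.sum_add_distrib, Finset.sum_sub_distrib,
    Finset.sum_sub_distrib, ← Finset.sum_div, ← Finset.sum_div, ← hMp, ← hMp2, ← Finset.sum_mul,
    ← hqs]
  field_simp
  ring

/-! ### The comparison principle and outermost horizons. -/

namespace RadialProfile

variable (P : RadialProfile)

lemma ip_unitNormal_le_one (f : E3 → ℝ) (y : E3) :
    P.metric.ip y (P.metric.unitNormal f y) (P.metric.unitNormal f y) ≤ 1 := by
  rw [RMetric.unitNormal, ip_smul_smul]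
  set N := P.metric.ip y (P.metric.grad f y) (P.metric.grad f y)
  rcases le_or_gt N 0 with h | h
  · simp [Real.sqrt_eq_zero'.2 h]
  · rw [inv_pow, Real.sq_sqrt h.le, inv_mul_cancel₀ h.ne']

lemma grad_contDiffAt {f : E3 → ℝ} {p : E3} (hf : ContDiffAt ℝ ∞ f p) :
    ContDiffAt ℝ 1 (P.metric.grad f) p := by
  have hG := eGrad_contDiffAt hf
  have ha : ContDiffAt ℝ 1 (fun x : E3 => P.a (‖x‖ ^ 2) / P.F (‖x‖ ^ 2)) p :=
    (((P.smooth.comp (contDiff_norm_sq ℝ)).of_le (mod_cast le_top)).contDiffAt).div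
      ((P.F_norm_smooth.of_le (mod_cast le_top)).contDiffAt) (P.F_pos p).ne'
  rw [show P.metric.grad f = _ from funext (P.grad_eq f)]
  exact hG.sub ((ha.mul (contDiffAt_id.inner ℝ hG)).smul contDiffAt_id)

lemma ip_grad_contDiffAt {f : E3 → ℝ} {p : E3} (hf : ContDiffAt ℝ ∞ f p) :
    ContDiffAt ℝ 1 (fun y => P.metric.ip y (P.metric.grad f y) (P.metric.grad f y)) p := by
  have hG := P.grad_contDiffAt hf
  have ha : ContDiffAt ℝ 1 (fun x : E3 => P.a (‖x‖ ^ 2)) p :=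
    ((P.smooth.comp (contDiff_norm_sq ℝ)).of_le (mod_cast le_top)).contDiffAt
  simp only [ip_eq]
  exact (hG.inner ℝ hG).add (ha.mul ((contDiffAt_id.inner ℝ hG).mul (contDiffAt_id.inner ℝ hG)))

/-- The derivative along a tangent vector `v` of the `v`-component of a multiple of the
gradient. -/
lemma hasDerivAt_inner_smul_grad {f : E3 → ℝ} {p : E3} (hf : ContDiffAt ℝ ∞ f p) {ρ : E3 → ℝ}
    (hρ : DifferentiableAt ℝ ρ p) {μ : ℝ} (hG : eGrad f p = μ • p) {v : E3}
    (hv : inner ℝ p v = 0) :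
    HasDerivAt (fun t : ℝ => inner ℝ v (ρ (p + t • v) • P.metric.grad f (p + t • v)))
      (ρ p * (fderiv ℝ (fderiv ℝ f) p v v
        - P.a (‖p‖ ^ 2) / P.F (‖p‖ ^ 2) * (μ * ‖p‖ ^ 2) * ‖v‖ ^ 2)) 0 := by
  have hcurve : HasDerivAt (fun t : ℝ => p + t • v) v 0 := by
    simpa using ((hasDerivAt_id (0 : ℝ)).smul_const v).const_add p
  let E : E3 → ℝ := fun y => P.a (‖y‖ ^ 2) / P.F (‖y‖ ^ 2) * inner ℝ y (eGrad f y)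
  have hEd : DifferentiableAt ℝ E p := by
    have h1 := (eGrad_contDiffAt hf).differentiableAt one_ne_zero
    have ha : DifferentiableAt ℝ (fun x : E3 => P.a (‖x‖ ^ 2)) p :=
      (P.smooth.comp (contDiff_norm_sq ℝ)).differentiable (by simp) p
    have hFd : DifferentiableAt ℝ (fun x : E3 => P.F (‖x‖ ^ 2)) p :=
      P.F_norm_smooth.differentiable (by simp) p
    have h2 : DifferentiableAt ℝ (fun y : E3 => (inner ℝ y (eGrad f y) : ℝ)) p :=
      differentiableAt_fun_id.inner ℝ h1
    have h3 : DifferentiableAt ℝ (fun x : E3 => P.a (‖x‖ ^ 2) / P.F (‖x‖ ^ 2)) p := by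
      simp only [div_eq_mul_inv]
      exact ha.mul (hFd.inv (P.F_pos p).ne')
    exact h3.mul h2
  have hEp : E p = P.a (‖p‖ ^ 2) / P.F (‖p‖ ^ 2) * (μ * ‖p‖ ^ 2) := by
    simp only [E, hG, real_inner_smul_right, real_inner_self_eq_norm_sq]
  have hcomp : ∀ (h : E3 → ℝ), DifferentiableAt ℝ h p →
      HasDerivAt (fun t : ℝ => h (p + t • v)) (fderiv ℝ h p v) 0 := fun h hd => by
    have h' : HasFDerivAt h (fderiv ℝ h p) (p + (0 : ℝ) • v) := by simpa using hd.hasFDerivAt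
    exact h'.comp_hasDerivAt 0 hcurve
  have hf2 : HasDerivAt (fun t : ℝ => fderiv ℝ f (p + t • v) v)
      (fderiv ℝ (fderiv ℝ f) p v v) 0 := by
    have h : HasFDerivAt (fderiv ℝ f) (fderiv ℝ (fderiv ℝ f) p) (p + (0 : ℝ) • v) := by
      simpa using
        ((hf.fderiv_right (m := 1) (by norm_cast)).differentiableAt one_ne_zero).hasFDerivAt
    have h1 : HasDerivAt (fun t : ℝ => fderiv ℝ f (p + t • v)) (fderiv ℝ (fderiv ℝ f) p v) 0 :=
      h.comp_hasDerivAt 0 hcurve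
    have h2 := h1.clm_apply (hasDerivAt_const (0 : ℝ) v)
    rw [map_zero, add_zero] at h2
    exact h2
  have hlin : HasDerivAt (fun t : ℝ => t * ‖v‖ ^ 2) (‖v‖ ^ 2) 0 := by
    simpa using (hasDerivAt_id (0 : ℝ)).mul_const (‖v‖ ^ 2)
  have h2 := (hcomp ρ hρ).mul (hf2.sub ((hcomp E hEd).mul hlin))
  -- At `p` the gradient is orthogonal to `v`, so the derivatives of `ρ` and `E` drop out.
  have hv0 : fderiv ℝ f p v = 0 := by
    rw [← inner_eGrad, hG, real_inner_smul_left, hv, mul_zero]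
  have hval : fderiv ℝ ρ p v * (fderiv ℝ f (p + (0 : ℝ) • v) v
        - E (p + (0 : ℝ) • v) * (0 * ‖v‖ ^ 2))
      + ρ (p + (0 : ℝ) • v) * (fderiv ℝ (fderiv ℝ f) p v v
        - (fderiv ℝ E p v * (0 * ‖v‖ ^ 2) + E (p + (0 : ℝ) • v) * ‖v‖ ^ 2))
      = ρ p * (fderiv ℝ (fderiv ℝ f) p v v - E p * ‖v‖ ^ 2) := by
    rw [zero_smul, add_zero, hv0]; ring
  rw [← hEp, ← hval]
  refine h2.congr_of_eventuallyEq (Eventually.of_forall fun t => ?_)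
  have hvt : inner ℝ v (p + t • v) = t * ‖v‖ ^ 2 := by
    rw [inner_add_right, real_inner_smul_right, real_inner_self_eq_norm_sq, real_inner_comm, hv,
      zero_add]
  show inner ℝ v (ρ (p + t • v) • P.metric.grad f (p + t • v)) = ρ (p + t • v) *
    (fderiv ℝ f (p + t • v) v - E (p + t • v) * (t * ‖v‖ ^ 2))
  rw [grad_eq, real_inner_smul_right, inner_sub_right, real_inner_smul_right, hvt,
    real_inner_comm, inner_eGrad]

/-- Comparison principle: a level set touching a centered sphere from inside has mean curvature
at least that of the sphere. -/
lemma meanCurv_ge_of_touching {f : E3 → ℝ} {p : E3} (hf : ContDiffAt ℝ ∞ f p) (hfp : f p = 0)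
    (hpos : ∀ᶠ x in 𝓝 p, ‖p‖ < ‖x‖ → 0 < f x) (hp : p ≠ 0) (hdf : fderiv ℝ f p ≠ 0) :
    2 / (√(P.F (‖p‖ ^ 2)) * ‖p‖) ≤ P.metric.meanCurv f p := by
  have hn : 0 < ‖p‖ := norm_pos_iff.2 hp
  have hF := P.F_pos p
  have hG := eGrad_eq_of_touching hf hfp hpos hp
  have hHess := fun v => hessian_ge_of_touching hf hfp hpos hp (v := v)
  set μ := fderiv ℝ f p p / ‖p‖ ^ 2 with hμdef
  have hμ : 0 < μ := by
    refine lt_of_le_of_ne (div_nonneg (fderiv_nonneg_of_touching hf hfp hpos hp)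
      (by positivity)) fun h => hdf ?_
    ext v
    rw [← inner_eGrad, hG, ← h]; simp
  have hN : 0 < P.metric.ip p (P.metric.grad f p) (P.metric.grad f p) := by
    rw [P.ip_grad_of_parallel hG]; positivity
  let ρ : E3 → ℝ := fun y =>
    P.metric.dens y * (√(P.metric.ip y (P.metric.grad f y) (P.metric.grad f y)))⁻¹
  let Y : E3 → E3 := fun y => P.metric.dens y • P.metric.unitNormal f y
  have hYρ : Y = fun y => ρ y • P.metric.grad f y := by
    funext y; simp only [Y, ρ, RMetric.unitNormal, smul_smul]
  have hρd : DifferentiableAt ℝ ρ p :=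
    ((P.dens_smooth.differentiable (by simp)) p).mul
      ((((P.ip_grad_contDiffAt hf).differentiableAt one_ne_zero).sqrt hN.ne').inv
        (Real.sqrt_ne_zero'.2 hN))
  have hGd : DifferentiableAt ℝ (P.metric.grad f) p :=
    (P.grad_contDiffAt hf).differentiableAt one_ne_zero
  have hYd : DifferentiableAt ℝ Y p := by rw [hYρ]; exact hρd.smul hGd
  have hYp : Y p = ‖p‖⁻¹ • p := P.dens_smul_unitNormal_of_parallel hp hμ hG
  have hρp : ρ p = P.F (‖p‖ ^ 2) / (μ * ‖p‖) := by
    have h1 : (ρ p * (μ / P.F (‖p‖ ^ 2))) • p = ‖p‖⁻¹ • p := by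
      rw [← hYp, hYρ, ← smul_smul, ← P.grad_eq_of_parallel hG]
    have h2 := smul_left_injective ℝ hp h1
    field_simp at h2 ⊢
    exact h2
  have hcurve : ∀ v : E3, HasDerivAt (fun t : ℝ => p + t • v) v 0 := fun v => by
    simpa using ((hasDerivAt_id (0 : ℝ)).smul_const v).const_add p
  have hYc : ∀ v : E3, HasDerivAt (fun t : ℝ => Y (p + t • v)) (fderiv ℝ Y p v) 0 := fun v => by
    have h : HasFDerivAt Y (fderiv ℝ Y p) (p + (0 : ℝ) • v) := by simpa using hYd.hasFDerivAt
    exact h.comp_hasDerivAt 0 (hcurve v)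
  -- The component of `Y` along `p` is at most `‖p‖` on the ray through `p`, with equality at `p`;
  -- at this maximum its derivative vanishes, so the radial direction contributes nothing to the
  -- divergence.
  have hrad : inner ℝ p (fderiv ℝ Y p p) = 0 := by
    have h1 : HasDerivAt (fun t : ℝ => ‖p‖ - inner ℝ p (Y (p + t • p)))
        (-inner ℝ p (fderiv ℝ Y p p)) 0 := by
      have := ((hasDerivAt_const (0 : ℝ) p).inner ℝ (hYc p)).const_sub ‖p‖
      simpa using this
    have hmin : IsLocalMin (fun t : ℝ => ‖p‖ - inner ℝ p (Y (p + t • p))) 0 := by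
      filter_upwards [Ioi_mem_nhds (show (-1 : ℝ) < 0 by norm_num)] with t ht
      have ht' : 0 < 1 + t := by have := mem_Ioi.1 ht; linarith
      have h2 := P.inner_dens_smul_le (P.ip_unitNormal_le_one f (p + t • p))
      rw [show P.metric.dens (p + t • p) • P.metric.unitNormal f (p + t • p) = Y (p + t • p)
        from rfl, show inner ℝ (Y (p + t • p)) (p + t • p) = (1 + t) * inner ℝ p (Y (p + t • p)) by
          rw [inner_add_right, real_inner_smul_right, real_inner_comm]; ring,
        show ‖p + t • p‖ = (1 + t) * ‖p‖ by
          rw [show p + t • p = (1 + t) • p by module, norm_smul, Real.norm_of_nonneg ht'.le]] at h2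
      have h3 := le_of_mul_le_mul_left h2 ht'
      simp only [zero_smul, add_zero, hYp, real_inner_smul_right, real_inner_self_eq_norm_sq]
      have : ‖p‖⁻¹ * ‖p‖ ^ 2 = ‖p‖ := by field_simp
      linarith
    have := hmin.hasDerivAt_eq_zero h1
    linarith
  -- The tangential part of the divergence is governed by the Hessian bound; equality would hold for
  -- the sphere itself.
  have htan : ∀ v : E3, inner ℝ p v = 0 →
      ρ p * (μ / P.F (‖p‖ ^ 2)) * ‖v‖ ^ 2 ≤ inner ℝ v (fderiv ℝ Y p v) := by
    intro v hv
    have h1 : HasDerivAt (fun t : ℝ => inner ℝ v (Y (p + t • v)))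
        (inner ℝ v (fderiv ℝ Y p v)) 0 := by
      simpa using (hasDerivAt_const (0 : ℝ) v).inner ℝ (hYc v)
    have h2 := P.hasDerivAt_inner_smul_grad hf hρd hG hv
    have h3 := (show HasDerivAt (fun t : ℝ => inner ℝ v (Y (p + t • v))) _ 0 by
      rw [hYρ]; exact h2).unique h1
    rw [← h3, mul_assoc]
    have hρ0 : 0 ≤ ρ p := by rw [hρp]; positivity
    refine mul_le_mul_of_nonneg_left ?_ hρ0
    have h4 := hHess v hv
    have h5 : μ / P.F (‖p‖ ^ 2)
        = μ - P.a (‖p‖ ^ 2) / P.F (‖p‖ ^ 2) * (μ * ‖p‖ ^ 2) := by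
      field_simp; rw [F]; ring
    rw [h5]
    linarith
  have hsum := sum_apply_single_eq (fderiv ℝ Y p) hp
  rw [hrad, zero_div, add_zero, ← eDiv_eq_sum_fderiv hYd] at hsum
  have hge : 2 / ‖p‖ ≤ eDiv Y p := by
    rw [hsum]
    have hproj : ∀ i : Fin 3, inner ℝ p (EuclideanSpace.single i 1 - (p i / ‖p‖ ^ 2) • p) = 0 := by
      intro i
      rw [inner_sub_right, EuclideanSpace.inner_single_right, real_inner_smul_right,
        real_inner_self_eq_norm_sq]
      simp
      field_simp
      ring
    have hnorm : ∀ i : Fin 3, ‖(EuclideanSpace.single i 1 - (p i / ‖p‖ ^ 2) • p : E3)‖ ^ 2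
        = 1 - p i ^ 2 / ‖p‖ ^ 2 := by
      intro i
      rw [norm_sub_sq_real, EuclideanSpace.inner_single_left, norm_smul]
      simp
      rw [mul_pow, div_pow, sq_abs]
      field_simp
      ring
    refine le_trans (le_of_eq ?_) (Finset.sum_le_sum fun i _ => htan _ (hproj i))
    simp only [hnorm]
    rw [← Finset.mul_sum, Finset.sum_sub_distrib, ← Finset.sum_div,
      show ∑ i, p i ^ 2 = ‖p‖ ^ 2 by rw [norm_sq_eq_sum, Fin.sum_univ_three], hρp]
    simp
    field_simp
    norm_num
  rw [meanCurv_eq, dens_eq]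
  have hs0 : 0 < √(P.F (‖p‖ ^ 2)) := Real.sqrt_pos.2 hF
  calc 2 / (√(P.F (‖p‖ ^ 2)) * ‖p‖) = (√(P.F (‖p‖ ^ 2)))⁻¹ * (2 / ‖p‖) := by field_simp
    _ ≤ _ := mul_le_mul_of_nonneg_left hge (by positivity)

lemma isOutermost_unitBall (hF : ∀ q, 1 < q → P.F q < 1 / q) :
    IsOutermost P.metric (ball 0 1) := by
  intro S ν hS hSne hSK hcmc
  obtain ⟨p, hpS, hmax⟩ := hS.exists_isMaxOn hSne (f := fun y => ‖y‖) (by fun_prop)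
  have hp1 : 1 < ‖p‖ := by
    have := hSK hpS
    rwa [closure_ball _ one_ne_zero, mem_compl_iff, mem_closedBall_zero_iff, not_le] at this
  have hp0 : p ≠ 0 := by rintro rfl; simp at hp1; linarith
  obtain ⟨U, f, hpU, hU, hH⟩ := hcmc p hpS
  have hHp := (hH p ⟨hpS, hpU⟩).2
  have hfs : ContDiffAt ℝ ∞ f p := hU.smooth.contDiffAt (hU.isOpen.mem_nhds hpU)
  have hfp : f p = 0 := (hU.zero_iff p hpU).1 hpS
  have hsq : 1 < ‖p‖ ^ 2 := by nlinarith
  have hgt : 2 < 2 / (√(P.F (‖p‖ ^ 2)) * ‖p‖) := by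
    have hs0 : 0 < √(P.F (‖p‖ ^ 2)) := Real.sqrt_pos.2 (P.F_pos p)
    rw [lt_div_iff₀ (by positivity)]
    have h1 := hF _ hsq
    rw [lt_div_iff₀ (by positivity)] at h1
    have : (√(P.F (‖p‖ ^ 2)) * ‖p‖) ^ 2 < 1 := by
      rw [mul_pow, Real.sq_sqrt (P.F_pos p).le]; exact h1
    have := (sq_lt_one_iff₀ (by positivity)).1 this
    linarith
  -- At a farthest point the normal may point either way. Outward, the mean curvature exceeds `2`;
  -- inward, it is less than `-2`.
  rcases constant_sign_outside_ball hU.isOpen hU.smooth.continuousOn hpU hp0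
    (fun x hx hpx h0 => absurd (hmax ((hU.zero_iff x hx).2 h0)) (not_le.2 hpx)) with hpos | hneg
  · have := P.meanCurv_ge_of_touching hfs hfp hpos hp0 (hU.regular p hpU)
    linarith
  · have := P.meanCurv_ge_of_touching (f := fun y => -f y) hfs.neg (by simp [hfp])
      (hneg.mono fun x hx hpx => neg_pos.2 (hx hpx)) hp0
      (by rw [fderiv_fun_neg]; simpa using hU.regular p hpU)
    rw [meanCurv_neg] at this
    linarith

end RadialProfile

/-! ### Christoffel symbols and scalar curvature. -/

lemma hasFDerivAt_coord (i : Fin 3) (x : E3) :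
    HasFDerivAt (fun y : E3 => y i) (EuclideanSpace.proj (𝕜 := ℝ) i : E3 →L[ℝ] ℝ) x :=
  (EuclideanSpace.proj (𝕜 := ℝ) i : E3 →L[ℝ] ℝ).hasFDerivAt

lemma hasFDerivAt_radial {h : ℝ → ℝ} {h' : ℝ} {x : E3} (hh : HasDerivAt h h' (‖x‖ ^ 2)) :
    HasFDerivAt (fun y : E3 => h (‖y‖ ^ 2)) (h' • (2 • innerSL ℝ x : E3 →L[ℝ] ℝ)) x :=
  hh.comp_hasFDerivAt x (hasStrictFDerivAt_norm_sq x).hasFDerivAt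

lemma proj_single (i l : Fin 3) : (EuclideanSpace.proj (𝕜 := ℝ) i : E3 →L[ℝ] ℝ)
    (EuclideanSpace.single l 1) = if l = i then 1 else 0 := by
  simp [PiLp.single_apply, eq_comm]

namespace RadialProfile

variable (P : RadialProfile)

lemma pd_coeff (l i j : Fin 3) (x : E3) :
    pd l (fun y => P.metric.coeff y i j) x =
      2 * deriv P.a (‖x‖ ^ 2) * (x l * x i * x j)
        + P.a (‖x‖ ^ 2) * ((if l = i then 1 else 0) * x j + x i * (if l = j then 1 else 0)) := by
  have ha : HasDerivAt P.a (deriv P.a (‖x‖ ^ 2)) (‖x‖ ^ 2) :=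
    (P.smooth.differentiable (by simp) _).hasDerivAt
  have h := ((hasFDerivAt_radial ha).fun_mul ((hasFDerivAt_coord i x).fun_mul
    (hasFDerivAt_coord j x))).const_add (if i = j then (1 : ℝ) else 0)
  have hc : (fun y => P.metric.coeff y i j) =
      fun y : E3 => (if i = j then (1 : ℝ) else 0) + P.a (‖y‖ ^ 2) * (y i * y j) := rfl
  rw [pd, hc]
  rw [h.fderiv]
  simp only [_root_.add_apply, _root_.smul_apply, innerSL_apply_apply, smul_eq_mul, nsmul_eq_mul,
    EuclideanSpace.inner_single_right, proj_single]
  simp [-mul_ite, -ite_mul]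
  ring

lemma christoffel_eq (k i j : Fin 3) (x : E3) :
    P.metric.christoffel k i j x = x k * (deriv P.a (‖x‖ ^ 2) / P.F (‖x‖ ^ 2) * (x i * x j)
      + P.a (‖x‖ ^ 2) / P.F (‖x‖ ^ 2) * (if i = j then 1 else 0)) := by
  have hF := (P.F_pos x).ne'
  have hq := norm_sq_eq_sum x
  have hF2 : P.F (‖x‖ ^ 2) = 1 + P.a (‖x‖ ^ 2) * ‖x‖ ^ 2 := rfl
  have h1 : ∀ l, pd i (fun y => P.metric.coeff y j l) x + pd j (fun y => P.metric.coeff y i l) x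
      - pd l (fun y => P.metric.coeff y i j) x
      = (2 * (deriv P.a (‖x‖ ^ 2) * (x i * x j) + P.a (‖x‖ ^ 2) * (if i = j then 1 else 0)))
        * x l := by
    intro l
    have e : ∀ r s : Fin 3, (if r = s then (1 : ℝ) else 0) = if s = r then 1 else 0 :=
      fun r s => by simp only [eq_comm]
    rw [pd_coeff, pd_coeff, pd_coeff, e j i, e l i, e l j]
    ring
  have h2 : ∑ l, P.metric.inv x k l * x l = x k / P.F (‖x‖ ^ 2) := by
    have : ∀ l, P.metric.inv x k l * x l = (if k = l then x l else 0)
        - P.a (‖x‖ ^ 2) / P.F (‖x‖ ^ 2) * x k * x l ^ 2 := fun l => by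
      rw [inv_eq]; split_ifs <;> ring
    simp only [this]
    rw [Finset.sum_sub_distrib, ← Finset.mul_sum, Finset.sum_ite_eq, Fin.sum_univ_three, ← hq]
    simp only [Finset.mem_univ, if_true]
    field_simp
    rw [hF2]; ring
  simp only [RMetric.christoffel, h1]
  rw [show ∑ l, P.metric.inv x k l *
    ((2 * (deriv P.a (‖x‖ ^ 2) * (x i * x j) + P.a (‖x‖ ^ 2) * (if i = j then 1 else 0))) * x l)
    = (2 * (deriv P.a (‖x‖ ^ 2) * (x i * x j) + P.a (‖x‖ ^ 2) * (if i = j then 1 else 0)))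
      * ∑ l, P.metric.inv x k l * x l by
        rw [Finset.mul_sum]; exact Finset.sum_congr rfl fun l _ => by ring, h2]
  ring

lemma pd_christoffel (l k i j : Fin 3) (x : E3) {b d : ℝ}
    (hb : HasDerivAt (fun q => deriv P.a q / P.F q) b (‖x‖ ^ 2))
    (hd : HasDerivAt (fun q => P.a q / P.F q) d (‖x‖ ^ 2)) :
    pd l (P.metric.christoffel k i j) x =
      (if l = k then 1 else 0) * (deriv P.a (‖x‖ ^ 2) / P.F (‖x‖ ^ 2) * (x i * x j)
        + P.a (‖x‖ ^ 2) / P.F (‖x‖ ^ 2) * (if i = j then 1 else 0))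
      + x k * (2 * b * (x l * x i * x j) + deriv P.a (‖x‖ ^ 2) / P.F (‖x‖ ^ 2) *
          ((if l = i then 1 else 0) * x j + x i * (if l = j then 1 else 0))
        + 2 * d * x l * (if i = j then 1 else 0)) := by
  have h := (hasFDerivAt_coord k x).fun_mul (((hasFDerivAt_radial hb).fun_mul
    ((hasFDerivAt_coord i x).fun_mul (hasFDerivAt_coord j x))).fun_add ((hasFDerivAt_radial hd).mul_const (if i = j then (1 : ℝ) else 0)))
  rw [pd, show P.metric.christoffel k i j = _ from funext (P.christoffel_eq k i j)]
  rw [h.fderiv]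
  simp only [_root_.add_apply, _root_.smul_apply, innerSL_apply_apply, smul_eq_mul, nsmul_eq_mul,
    EuclideanSpace.inner_single_right, proj_single]
  simp [-mul_ite, -ite_mul]
  ring

/-- With `1/F = s⁸` the scalar curvature is `2(1 - s⁸)/s² - 16 s⁶`, about `-1151` at `s = 2`. The
Christoffel symbols involve the profile only through `a/F` and `a'/F`, which are explicit near `q =
4`, so their values and first derivatives there suffice. -/
lemma scal_lt (ha : ∀ᶠ q in 𝓝 (4 : ℝ), P.a q = ((q ^ 4)⁻¹ - 1) / q) :
    P.metric.scal (EuclideanSpace.single 0 2) < -6 := by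
  have hane : ∀ᶠ q in 𝓝 (4 : ℝ), 0 < q := lt_mem_nhds (by norm_num)
  have hF : ∀ᶠ q in 𝓝 (4 : ℝ), P.F q = (q ^ 4)⁻¹ := by
    filter_upwards [ha, hane] with q h1 h2
    rw [F, h1]; field_simp; ring
  have hd : (fun q => P.a q / P.F q) =ᶠ[𝓝 4] fun q => q⁻¹ - q ^ 3 := by
    filter_upwards [ha, hF, hane] with q h1 h2 h3
    rw [h1, h2]; field_simp
  have ha' : ∀ᶠ q in 𝓝 (4 : ℝ), deriv P.a q = -5 * (q ^ 6)⁻¹ + (q ^ 2)⁻¹ := by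
    filter_upwards [ha.eventually_nhds, hane] with q h1 h3
    have h4 : HasDerivAt (fun q : ℝ => ((q ^ 4)⁻¹ - 1) / q)
        (-5 * (q ^ 6)⁻¹ + (q ^ 2)⁻¹) q := by
      have := (((hasDerivAt_pow 4 q).inv (pow_ne_zero 4 h3.ne')).sub_const 1).div
        (hasDerivAt_id q) h3.ne'
      refine this.congr_deriv ?_
      simp
      field_simp
      ring
    rw [EventuallyEq.deriv_eq h1, h4.deriv]
  have hb : (fun q => deriv P.a q / P.F q) =ᶠ[𝓝 4] fun q => -5 * (q ^ 2)⁻¹ + q ^ 2 := by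
    filter_upwards [ha', hF, hane] with q h1 h2 h3
    rw [h1, h2]; field_simp
  have hx : ‖(EuclideanSpace.single 0 2 : E3)‖ ^ 2 = 4 := by
    simp; norm_num
  have hd' : HasDerivAt (fun q => P.a q / P.F q) (-(1 / 16) - 48) 4 := by
    have : HasDerivAt (fun q : ℝ => q⁻¹ - q ^ 3) (-(1 / 16) - 48) 4 := by
      refine ((hasDerivAt_inv (by norm_num)).sub (hasDerivAt_pow 3 (4 : ℝ))).congr_deriv ?_
      norm_num
    exact this.congr_of_eventuallyEq hd
  have hb' : HasDerivAt (fun q => deriv P.a q / P.F q) (10 / 64 + 8) 4 := by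
    have : HasDerivAt (fun q : ℝ => -5 * (q ^ 2)⁻¹ + q ^ 2) (10 / 64 + 8) 4 := by
      refine ((((hasDerivAt_pow 2 (4 : ℝ)).inv (by norm_num)).const_mul (-5)).add
        (hasDerivAt_pow 2 (4 : ℝ))).congr_deriv ?_
      norm_num
    exact this.congr_of_eventuallyEq hb
  have hd0 : P.a 4 / P.F 4 = 1 / 4 - 64 := by rw [hd.eq_of_nhds]; norm_num
  have hb0 : deriv P.a 4 / P.F 4 = -5 / 16 + 16 := by rw [hb.eq_of_nhds]; norm_num
  have hpd : ∀ l k i j : Fin 3, _ := fun l k i j =>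
    P.pd_christoffel l k i j (EuclideanSpace.single 0 2) (hx.symm ▸ hb') (hx.symm ▸ hd')
  simp only [hx, hb0, hd0] at hpd
  simp only [RMetric.scal, RMetric.ricci, inv_eq, hpd, christoffel_eq, hx, hb0, hd0,
    Fin.sum_univ_three, PiLp.single_apply]
  simp
  norm_num

/-! ### Geodesic radial coordinate and warped product form. -/

/-- The distance to the origin, as a function of the radial coordinate. -/
def dist (s : ℝ) : ℝ := ∫ u in (0 : ℝ)..s, √(P.F (u ^ 2))

lemma sqrt_F_sq_pos (u : ℝ) : 0 < √(P.F (u ^ 2)) := Real.sqrt_pos.2 (P.pos _ (sq_nonneg u))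

lemma sqrt_F_sq_smooth : ContDiff ℝ ∞ (fun u : ℝ => √(P.F (u ^ 2))) :=
  (P.F_smooth.comp (contDiff_id.pow 2)).sqrt fun u => (P.pos _ (sq_nonneg u)).ne'

lemma hasDerivAt_dist (s : ℝ) : HasDerivAt P.dist √(P.F (s ^ 2)) s :=
  intervalIntegral.integral_hasDerivAt_right (P.sqrt_F_sq_smooth.continuous.intervalIntegrable _ _)
    (P.sqrt_F_sq_smooth.continuous.stronglyMeasurableAtFilter _ _)
    P.sqrt_F_sq_smooth.continuous.continuousAt

lemma dist_smooth : ContDiff ℝ ∞ P.dist := by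
  rw [contDiff_infty_iff_deriv]
  refine ⟨fun s => (P.hasDerivAt_dist s).differentiableAt, ?_⟩
  rw [show deriv P.dist = _ from funext fun s => (P.hasDerivAt_dist s).deriv]
  exact P.sqrt_F_sq_smooth

lemma dist_strictMono : StrictMono P.dist :=
  strictMono_of_deriv_pos fun s => by
    rw [(P.hasDerivAt_dist s).deriv]; exact P.sqrt_F_sq_pos s

lemma dist_neg (s : ℝ) : P.dist (-s) = -P.dist s := by
  have h := intervalIntegral.integral_comp_neg (fun u => √(P.F (u ^ 2))) (a := 0) (b := s)
  simp only [neg_sq, neg_zero] at h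
  rw [dist, dist, h, intervalIntegral.integral_symm]

lemma dist_zero : P.dist 0 = 0 := intervalIntegral.integral_same

variable {P}

/-- Beyond `q₀` the metric dominates the hyperbolic one in the radial direction, whose distance
function is `arsinh`. -/
lemma tendsto_dist_atTop {q₀ : ℝ} (hF : ∀ q, q₀ ≤ q → (1 + q)⁻¹ ≤ P.F q) :
    Tendsto P.dist atTop atTop := by
  set s₀ := max q₀ 1
  have h1 : 1 ≤ s₀ := le_max_right _ _
  have hmono : MonotoneOn (fun s => P.dist s - Real.arsinh s) (Ici s₀) := by
    refine monotoneOn_of_deriv_nonneg (convex_Ici _)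
      ((P.dist_smooth.continuous.sub Real.continuous_arsinh).continuousOn)
      (fun s _ => ((P.hasDerivAt_dist s).sub
        (Real.hasDerivAt_arsinh s)).differentiableAt.differentiableWithinAt) fun s hs => ?_
    rw [interior_Ici, mem_Ioi] at hs
    rw [((P.hasDerivAt_dist s).fun_sub (Real.hasDerivAt_arsinh s)).deriv, sub_nonneg,
      ← Real.sqrt_inv]
    apply Real.sqrt_le_sqrt
    apply hF
    have : q₀ ≤ s₀ := le_max_left _ _
    nlinarith
  have hlim : Tendsto (fun s => Real.arsinh s + (P.dist s₀ - Real.arsinh s₀)) atTop atTop :=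
    tendsto_atTop_add_const_right _ _
      (Real.arsinh_strictMono.monotone.tendsto_atTop_atTop fun b => by
        obtain ⟨a, ha⟩ := Real.arsinh_surjective b
        exact ⟨a, ha.ge⟩)
  refine tendsto_atTop_mono' _ ?_ hlim
  filter_upwards [eventually_ge_atTop s₀] with s hs
  have := hmono self_mem_Ici hs hs
  simp only at this
  linarith

lemma dist_surjective {q₀ : ℝ} (hF : ∀ q, q₀ ≤ q → (1 + q)⁻¹ ≤ P.F q) :
    Function.Surjective P.dist := by
  have htop := tendsto_dist_atTop hF
  refine P.dist_smooth.continuous.surjective htop ?_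
  have : P.dist = fun s => -P.dist (-s) := by funext s; rw [dist_neg, neg_neg]
  rw [this]
  exact tendsto_neg_atTop_atBot.comp (htop.comp tendsto_neg_atBot_atTop)

/-- The rotationally symmetric metric is a warped product outside the unit ball. -/
lemma exists_isWarpedProduct {q₀ : ℝ} (hF : ∀ q, q₀ ≤ q → (1 + q)⁻¹ ≤ P.F q) :
    ∃ (r₀ : ℝ) (φ : ℝ → ℝ), 0 < r₀ ∧ ContDiff ℝ ∞ φ ∧ (∀ r ∈ Ici r₀, 0 < φ r) ∧
      IsWarpedProduct r₀ φ (ball 0 1) P.metric := by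
  -- Integrating `√F` over the whole line makes the distance an odd diffeomorphism of `ℝ`, so its
  -- inverse is smooth without boundary considerations.
  let e : ℝ ≃ₜ ℝ :=
    (StrictMono.orderIsoOfSurjective _ P.dist_strictMono (dist_surjective hF)).toHomeomorph
  have he : ∀ s, e s = P.dist s := fun s => rfl
  have hes : ContDiff ℝ ∞ e.symm := Homeomorph.contDiff_symm_deriv e
    (fun s => (P.sqrt_F_sq_pos s).ne') P.hasDerivAt_dist P.dist_smooth
  have hder : ∀ r, HasDerivAt e.symm (√(P.F (e.symm r ^ 2)))⁻¹ r := fun r =>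
    (P.hasDerivAt_dist (e.symm r)).of_local_left_inverse e.symm.continuous.continuousAt
      (P.sqrt_F_sq_pos _).ne' (Eventually.of_forall e.apply_symm_apply)
  have hr₀ : 0 < P.dist 1 := by
    rw [← P.dist_zero]; exact P.dist_strictMono one_pos
  have hge : ∀ r, P.dist 1 ≤ r ↔ 1 ≤ e.symm r := fun r => by
    rw [← P.dist_strictMono.le_iff_le (a := 1), ← he (e.symm r), e.apply_symm_apply]
  have hnorm : ∀ r ∈ Ici (P.dist 1), ∀ θ ∈ sphere (0 : E3) 1, ‖polarMap e.symm (r, θ)‖ = e.symm r := by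
    intro r hr θ hθ
    have := (hge r).1 hr
    rw [polarMap, norm_smul, mem_sphere_zero_iff_norm.1 hθ, mul_one, Real.norm_of_nonneg]
    linarith
  have hpre : ∀ x : E3, 1 ≤ ‖x‖ → ‖x‖⁻¹ • x ∈ sphere (0 : E3) 1 ∧
      polarMap e.symm (P.dist ‖x‖, ‖x‖⁻¹ • x) = x := by
    intro x hx
    have hx0 : ‖x‖ ≠ 0 := by linarith
    refine ⟨?_, ?_⟩
    · rw [mem_sphere_zero_iff_norm, norm_smul, norm_inv, norm_norm, inv_mul_cancel₀ hx0]
    · simp only [polarMap]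
      rw [← he, e.symm_apply_apply, smul_inv_smul₀ hx0]
  -- The inverse distance serves both as `φ` and as `σ`, since `s` is the area radius.
  refine ⟨P.dist 1, e.symm, hr₀, hes, fun r hr => ?_, e.symm, hes, ⟨?_, ?_, ?_⟩, ?_, ?_⟩
  · have := (hge r).1 hr; linarith
  · rintro ⟨r, θ⟩ ⟨hr, hθ⟩
    rw [mem_compl_iff, mem_ball_zero_iff, not_lt, hnorm r hr θ hθ]
    exact (hge r).1 hr
  · rintro ⟨r, θ⟩ ⟨hr, hθ⟩ ⟨r', θ'⟩ ⟨hr', hθ'⟩ h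
    have hrr : e.symm r = e.symm r' := by rw [← hnorm r hr θ hθ, h, hnorm r' hr' θ' hθ']
    have hpos : e.symm r ≠ 0 := by have := (hge r).1 hr; linarith
    simp only [polarMap] at h
    rw [← hrr] at h
    rw [smul_right_injective E3 hpos h, e.symm.injective hrr]
  · intro x hx
    rw [mem_compl_iff, mem_ball_zero_iff, not_lt] at hx
    exact ⟨(P.dist ‖x‖, ‖x‖⁻¹ • x), ⟨P.dist_strictMono.monotone hx, (hpre x hx).1⟩, (hpre x hx).2⟩
  · rw [frontier_ball _ one_ne_zero]
    ext x
    constructor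
    · rintro ⟨⟨r, θ⟩, ⟨rfl, hθ⟩, rfl⟩
      rw [mem_sphere_zero_iff_norm, hnorm _ self_mem_Ici θ hθ, ← he, e.symm_apply_apply]
    · intro hx
      have hx' := mem_sphere_zero_iff_norm.1 hx
      refine ⟨(P.dist ‖x‖, ‖x‖⁻¹ • x), ⟨?_, (hpre x hx'.ge).1⟩, (hpre x hx'.ge).2⟩
      rw [hx']; exact mem_singleton _
  · intro r hr θ hθ a τ hτ
    have hθ1 := mem_sphere_zero_iff_norm.1 hθ
    have hd : HasFDerivAt (polarMap e.symm) (e.symm r • ContinuousLinearMap.snd ℝ ℝ E3 +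
        ((ContinuousLinearMap.smulRight (1 : ℝ →L[ℝ] ℝ) (√(P.F (e.symm r ^ 2)))⁻¹).comp
          (ContinuousLinearMap.fst ℝ ℝ E3)).smulRight θ) (r, θ) := by
      have h1 : HasFDerivAt (fun p : ℝ × E3 => e.symm p.1)
          ((ContinuousLinearMap.smulRight (1 : ℝ →L[ℝ] ℝ) (√(P.F (e.symm r ^ 2)))⁻¹).comp
          (ContinuousLinearMap.fst ℝ ℝ E3)) (r, θ) :=
        (hder r).hasFDerivAt.comp (r, θ) hasFDerivAt_fst
      exact h1.smul hasFDerivAt_snd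
    rw [hd.fderiv, ip_eq, hnorm r hr θ hθ]
    have hF0 : 0 < P.F (e.symm r ^ 2) := P.pos _ (sq_nonneg _)
    have hs : √(P.F (e.symm r ^ 2)) ^ 2 = P.F (e.symm r ^ 2) := Real.sq_sqrt hF0.le
    have hFd : P.F (e.symm r ^ 2) = 1 + P.a (e.symm r ^ 2) * e.symm r ^ 2 := rfl
    have hinv : (√(P.F (e.symm r ^ 2)))⁻¹ ^ 2 * (1 + P.a (e.symm r ^ 2) * e.symm r ^ 2) = 1 := by
      rw [inv_pow, hs, ← hFd, inv_mul_cancel₀ hF0.ne']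
    generalize (√(P.F (e.symm r ^ 2)))⁻¹ = c at *
    simp only [polarMap, _root_.add_apply, _root_.smul_apply, ContinuousLinearMap.smulRight_apply,
      ContinuousLinearMap.comp_apply, ContinuousLinearMap.coe_snd', ContinuousLinearMap.coe_fst',
      one_apply_eq_self, inner_add_left, inner_add_right, real_inner_smul_left,
      real_inner_smul_right, smul_eq_mul, real_inner_self_eq_norm_sq, norm_smul, mul_pow, Real.norm_eq_abs, sq_abs, hθ1,
      hτ, real_inner_comm θ τ]
    linear_combination a ^ 2 * hinv

end RadialProfile

/-! ### Hyperbolic translations and hyperbolic balls in hyperboloid coordinates. -/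

/-- The zeroth coordinate vector. -/
abbrev e₀ : E3 := EuclideanSpace.single 0 1

/-- The Lorentz factor `√(1 + |y|²)` of a point of the hyperboloid over `y`. -/
def lorentz (y : E3) : ℝ := √(1 + ‖y‖ ^ 2)

lemma lorentz_pos (y : E3) : 0 < lorentz y := Real.sqrt_pos.2 (by positivity)

lemma lorentz_sq (y : E3) : lorentz y ^ 2 = 1 + ‖y‖ ^ 2 := Real.sq_sqrt (by positivity)

lemma lorentz_smooth : ContDiff ℝ ∞ lorentz :=
  (contDiff_const.add (contDiff_norm_sq ℝ)).sqrt fun y => by positivity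

lemma det_id_add_smulRight (ℓ : E3 →L[ℝ] ℝ) (e : E3) :
    (ContinuousLinearMap.id ℝ E3 + ℓ.smulRight e).det = 1 + ℓ e := by
  have : (↑(ContinuousLinearMap.id ℝ E3 + ℓ.smulRight e) : E3 →ₗ[ℝ] E3)
      = LinearMap.transvection ℓ.toLinearMap e := by
    ext v; simp [LinearMap.transvection]
  rw [ContinuousLinearMap.det, this, LinearMap.transvection.det]
  rfl

/-- The hyperbolic translation by `t` along the zeroth coordinate axis, in the coordinates
of the hyperboloid model. -/
def boost (t : ℝ) (y : E3) : E3 :=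
  y + ((Real.cosh t - 1) * y 0 + Real.sinh t * lorentz y) • e₀

lemma boost_zero (t : ℝ) (y : E3) :
    boost t y 0 = Real.cosh t * y 0 + Real.sinh t * lorentz y := by
  simp [boost]; ring

lemma boost_one (t : ℝ) (y : E3) : boost t y 1 = y 1 := by simp [boost]

lemma boost_two (t : ℝ) (y : E3) : boost t y 2 = y 2 := by simp [boost]

lemma abs_coord_lt_lorentz (y : E3) : |y 0| < lorentz y := by
  apply Real.lt_sqrt_of_sq_lt
  rw [sq_abs, norm_sq_eq_sum]
  nlinarith [sq_nonneg (y 1), sq_nonneg (y 2)]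

lemma lorentz_boost_pos (t : ℝ) (y : E3) :
    0 < Real.cosh t * lorentz y + Real.sinh t * y 0 := by
  have h1 := abs_lt.1 (abs_coord_lt_lorentz y)
  have h2 := Real.cosh_sq t
  have h3 := Real.cosh_pos t
  have h4 : |Real.sinh t| ≤ Real.cosh t := abs_le_of_sq_le_sq (by linarith) h3.le
  have h5 : |Real.sinh t * y 0| < Real.cosh t * lorentz y := by
    rw [abs_mul]
    calc |Real.sinh t| * |y 0| ≤ Real.cosh t * |y 0| := by gcongr
      _ < _ := by gcongr; exact abs_coord_lt_lorentz y
  linarith [(abs_lt.1 h5).1]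

lemma lorentz_boost (t : ℝ) (y : E3) :
    lorentz (boost t y) = Real.cosh t * lorentz y + Real.sinh t * y 0 := by
  refine (sq_eq_sq₀ (lorentz_pos _).le (lorentz_boost_pos t y).le).1 ?_
  rw [lorentz_sq, norm_sq_eq_sum (boost t y), boost_zero, boost_one, boost_two]
  have h1 := lorentz_sq y
  rw [norm_sq_eq_sum] at h1
  have h2 := Real.cosh_sq t
  linear_combination (y 0 ^ 2 - lorentz y ^ 2) * h2 - h1

lemma boost_injective (t : ℝ) : Function.Injective (boost t) := by
  intro y z h
  have h0 : boost t y 0 = boost t z 0 := by rw [h]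
  have h1 : boost t y 1 = boost t z 1 := by rw [h]
  have h2 : boost t y 2 = boost t z 2 := by rw [h]
  have h3 : lorentz (boost t y) = lorentz (boost t z) := by rw [h]
  rw [boost_zero, boost_zero] at h0
  rw [boost_one, boost_one] at h1
  rw [boost_two, boost_two] at h2
  rw [lorentz_boost, lorentz_boost] at h3
  have hc := Real.cosh_sq t
  ext i
  fin_cases i
  · show y 0 = z 0
    linear_combination Real.cosh t * h0 - Real.sinh t * h3 - (y 0 - z 0) * hc
  · exact h1
  · exact h2

lemma hasFDerivAt_boost (t : ℝ) (y : E3) :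
    HasFDerivAt (boost t) (ContinuousLinearMap.id ℝ E3 +
      ((Real.cosh t - 1) • (EuclideanSpace.proj (𝕜 := ℝ) 0 : E3 →L[ℝ] ℝ)
        + Real.sinh t • ((lorentz y)⁻¹ • innerSL ℝ y)).smulRight e₀) y := by
  have hl : HasFDerivAt lorentz ((lorentz y)⁻¹ • innerSL ℝ y) y := by
    have h1 : HasFDerivAt (fun y : E3 => 1 + ‖y‖ ^ 2) (2 • innerSL ℝ y : E3 →L[ℝ] ℝ) y :=
      (hasStrictFDerivAt_norm_sq y).hasFDerivAt.const_add 1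
    have h2 : HasFDerivAt lorentz ((1 / (2 * √(1 + ‖y‖ ^ 2))) • (2 • innerSL ℝ y : E3 →L[ℝ] ℝ)) y :=
      h1.sqrt (by positivity)
    refine h2.congr_fderiv ?_
    ext v
    simp [lorentz]
    field_simp
  exact (hasFDerivAt_id y).add
    ((((hasFDerivAt_coord 0 y).const_mul _).add (hl.const_mul _)).smul_const e₀)

/-- Hyperbolic translations preserve the hyperbolic volume. -/
lemma setIntegral_boost_inv_lorentz (t : ℝ) {s : Set E3} (hs : MeasurableSet s) :
    ∫ x in boost t '' s, (lorentz x)⁻¹ = ∫ y in s, (lorentz y)⁻¹ := by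
  rw [integral_image_eq_integral_abs_det_fderiv_smul volume hs
    (fun y _ => (hasFDerivAt_boost t y).hasFDerivWithinAt) (boost_injective t).injOn]
  refine integral_congr_ae (ae_of_all _ fun y => ?_)
  have hpos := lorentz_boost_pos t y
  have hl := lorentz_pos y
  have hdet : (ContinuousLinearMap.id ℝ E3 +
      ((Real.cosh t - 1) • (EuclideanSpace.proj (𝕜 := ℝ) 0 : E3 →L[ℝ] ℝ)
        + Real.sinh t • ((lorentz y)⁻¹ • innerSL ℝ y)).smulRight e₀).det
      = (Real.cosh t * lorentz y + Real.sinh t * y 0) / lorentz y := by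
    rw [det_id_add_smulRight]
    simp [EuclideanSpace.inner_single_right]
    field_simp
    ring
  simp only [hdet]
  rw [lorentz_boost, abs_of_pos (by positivity), smul_eq_mul]
  field_simp

/-- The affine map taking the Euclidean ball of radius `sinh ρ` to the hyperbolic ball of
radius `ρ` centered at distance `t` from the origin. -/
def ballChart (t ρ : ℝ) (y : E3) : E3 :=
  y + ((Real.cosh t - 1) * y 0 + Real.cosh ρ * Real.sinh t) • e₀

lemma ballChart_zero (t ρ : ℝ) (y : E3) :
    ballChart t ρ y 0 = Real.cosh t * y 0 + Real.cosh ρ * Real.sinh t := by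
  simp [ballChart]; ring

lemma ballChart_one (t ρ : ℝ) (y : E3) : ballChart t ρ y 1 = y 1 := by simp [ballChart]

lemma ballChart_two (t ρ : ℝ) (y : E3) : ballChart t ρ y 2 = y 2 := by simp [ballChart]

/-- On the sphere `‖y‖ = sinh ρ` the Lorentz factor is the constant `cosh ρ`, so the boost there
coincides with the affine chart. The last term vanishes on that sphere and its sign tells inside
from outside. -/
lemma one_add_norm_sq_ballChart (t ρ : ℝ) (y : E3) :
    1 + ‖ballChart t ρ y‖ ^ 2
      = (Real.cosh ρ * Real.cosh t + Real.sinh t * y 0) ^ 2 + (‖y‖ ^ 2 - Real.sinh ρ ^ 2) := by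
  rw [norm_sq_eq_sum, norm_sq_eq_sum, ballChart_zero, ballChart_one, ballChart_two]
  linear_combination (y 0 ^ 2 - Real.cosh ρ ^ 2) * Real.cosh_sq t - Real.cosh_sq ρ

lemma hasFDerivAt_ballChart (t ρ : ℝ) (y : E3) :
    HasFDerivAt (ballChart t ρ) (ContinuousLinearMap.id ℝ E3 +
      ((Real.cosh t - 1) • (EuclideanSpace.proj (𝕜 := ℝ) 0 : E3 →L[ℝ] ℝ)).smulRight e₀) y :=
  (hasFDerivAt_id y).add
    ((((hasFDerivAt_coord 0 y).const_mul _).add_const _).smul_const e₀)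

lemma continuous_ballChart (t ρ : ℝ) : Continuous (ballChart t ρ) :=
  continuous_iff_continuousAt.2 fun y => (hasFDerivAt_ballChart t ρ y).continuousAt

lemma ballChart_injective (t ρ : ℝ) : Function.Injective (ballChart t ρ) := by
  intro y z h
  have h0 : ballChart t ρ y 0 = ballChart t ρ z 0 := by rw [h]
  have h1 : ballChart t ρ y 1 = ballChart t ρ z 1 := by rw [h]
  have h2 : ballChart t ρ y 2 = ballChart t ρ z 2 := by rw [h]
  rw [ballChart_zero, ballChart_zero] at h0
  rw [ballChart_one, ballChart_one] at h1
  rw [ballChart_two, ballChart_two] at h2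
  have hc := Real.cosh_pos t
  ext i
  fin_cases i
  · show y 0 = z 0
    exact mul_left_cancel₀ hc.ne' (by linarith)
  · exact h1
  · exact h2

/-- The hyperbolic ball of radius `ρ` centered at distance `t` from the origin. -/
def hypBall (t ρ : ℝ) : Set E3 := ballChart t ρ '' closedBall 0 (Real.sinh ρ)

lemma isCompact_hypBall (t ρ : ℝ) : IsCompact (hypBall t ρ) :=
  (isCompact_closedBall _ _).image (continuous_ballChart t ρ)

lemma measurableSet_hypBall (t ρ : ℝ) : MeasurableSet (hypBall t ρ) :=
  (isCompact_hypBall t ρ).measurableSet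

lemma le_norm_of_mem_hypBall {t ρ : ℝ} {x : E3} (hx : x ∈ hypBall t ρ) :
    Real.sinh (t - ρ) ≤ ‖x‖ := by
  obtain ⟨y, hy, rfl⟩ := hx
  rw [mem_closedBall_zero_iff] at hy
  have h1 := (abs_le.1 ((PiLp.norm_apply_le y 0).trans hy)).1
  refine le_trans ?_ ((le_abs_self _).trans (PiLp.norm_apply_le (ballChart t ρ y) 0))
  rw [ballChart_zero, Real.sinh_sub]
  nlinarith [Real.cosh_pos t]

lemma setIntegral_hypBall (t ρ : ℝ) (f : E3 → ℝ) :
    ∫ x in hypBall t ρ, f x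
      = ∫ y in closedBall (0 : E3) (Real.sinh ρ), Real.cosh t * f (ballChart t ρ y) := by
  rw [hypBall, integral_image_eq_integral_abs_det_fderiv_smul volume measurableSet_closedBall
    (fun y _ => (hasFDerivAt_ballChart t ρ y).hasFDerivWithinAt) (ballChart_injective t ρ).injOn]
  have hdet : (ContinuousLinearMap.id ℝ E3 + ((Real.cosh t - 1) •
      (EuclideanSpace.proj (𝕜 := ℝ) 0 : E3 →L[ℝ] ℝ)).smulRight e₀).det = Real.cosh t := by
    rw [det_id_add_smulRight]; simp
  simp only [hdet, abs_of_pos (Real.cosh_pos t), smul_eq_mul]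

/-- One inclusion is enough, as only a lower bound for the volume of `hypBall` is needed. -/
lemma image_boost_subset_hypBall (t : ℝ) {ρ : ℝ} (hρ : 0 ≤ ρ) :
    boost t '' closedBall 0 (Real.sinh ρ) ⊆ hypBall t ρ := by
  rintro _ ⟨y, hy, rfl⟩
  rw [mem_closedBall_zero_iff] at hy
  have hS : 0 ≤ Real.sinh ρ := Real.sinh_nonneg_iff.2 hρ
  have hc := Real.cosh_pos t
  have hC := Real.cosh_pos ρ
  have hct := Real.cosh_sq t
  -- The preimage of the boosted point under the affine chart; it remains to see that it lies in the
  -- Euclidean ball.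
  set z : E3 := y + ((boost t y 0 - Real.cosh ρ * Real.sinh t) / Real.cosh t - y 0) • e₀ with hz
  have hz0 : z 0 = (boost t y 0 - Real.cosh ρ * Real.sinh t) / Real.cosh t := by simp [hz]
  have hzb : ballChart t ρ z = boost t y := by
    ext i
    fin_cases i
    · show ballChart t ρ z 0 = boost t y 0
      rw [ballChart_zero, hz0]; field_simp; ring
    · show ballChart t ρ z 1 = boost t y 1
      rw [ballChart_one, boost_one]; simp [hz]
    · show ballChart t ρ z 2 = boost t y 2
      rw [ballChart_two, boost_two]; simp [hz]
  refine ⟨z, ?_, hzb⟩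
  rw [mem_closedBall_zero_iff]
  refine le_of_sq_le_sq ?_ hS
  have h1 := one_add_norm_sq_ballChart t ρ z
  rw [hzb, ← lorentz_sq] at h1
  have h2 : lorentz y ≤ Real.cosh ρ := by
    refine le_of_sq_le_sq ?_ hC.le
    rw [lorentz_sq, Real.cosh_sq]
    have : ‖y‖ ^ 2 ≤ Real.sinh ρ ^ 2 := by gcongr
    linarith
  have h3 : Real.cosh t * lorentz (boost t y) - Real.sinh t * boost t y 0 = lorentz y := by
    rw [lorentz_boost, boost_zero]; linear_combination lorentz y * hct
  have h4 : lorentz (boost t y) ≤ Real.cosh ρ * Real.cosh t + Real.sinh t * z 0 := by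
    have : Real.cosh t * (Real.cosh ρ * Real.cosh t + Real.sinh t * z 0)
        = Real.cosh ρ + Real.sinh t * boost t y 0 := by
      rw [hz0]; field_simp; linear_combination Real.cosh ρ * hct
    refine le_of_mul_le_mul_left ?_ hc
    rw [this]; linarith
  have h5 : lorentz (boost t y) ^ 2 ≤ (Real.cosh ρ * Real.cosh t + Real.sinh t * z 0) ^ 2 := by
    have := (lorentz_pos (boost t y)).le
    gcongr
  linarith

lemma continuous_inv_lorentz : Continuous fun y : E3 => (lorentz y)⁻¹ :=
  lorentz_smooth.continuous.inv₀ fun y => (lorentz_pos y).ne'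

lemma le_setIntegral_hypBall_inv_lorentz (t : ℝ) {ρ : ℝ} (hρ : 0 ≤ ρ) :
    ∫ y in closedBall (0 : E3) (Real.sinh ρ), (lorentz y)⁻¹ ≤ ∫ x in hypBall t ρ, (lorentz x)⁻¹ := by
  rw [← setIntegral_boost_inv_lorentz t measurableSet_closedBall]
  exact setIntegral_mono_set
    (continuous_inv_lorentz.continuousOn.integrableOn_compact (isCompact_hypBall t ρ))
    (ae_of_all _ fun x => (inv_pos.2 (lorentz_pos x)).le)
    (image_boost_subset_hypBall t hρ).eventuallyLE

/-- The Cauchy-Schwarz inequality for the hyperbolic metric and its inverse. -/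
lemma inner_sq_le_of_hyperbolic {x X n : E3}
    (hX : ‖X‖ ^ 2 - inner ℝ x X ^ 2 / (1 + ‖x‖ ^ 2) ≤ 1) :
    inner ℝ X n ^ 2 ≤ ‖n‖ ^ 2 + inner ℝ x n ^ 2 := by
  set D := ‖n‖ ^ 2 + inner ℝ x n ^ 2 with hD
  set u := inner ℝ X n with hu
  set b := inner ℝ x X with hb
  have hq : 0 < 1 + ‖x‖ ^ 2 := by positivity
  have hD0 : 0 ≤ D := by positivity
  rcases hD0.eq_or_lt with h | hDpos
  · have : ‖n‖ ^ 2 = 0 := by nlinarith [sq_nonneg ‖n‖, sq_nonneg (inner ℝ x n)]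
    have hn : n = 0 := by simpa using this
    rw [hu, hn]; simp [hD0]
  have hpos : ∀ w : E3, 0 ≤ ‖w‖ ^ 2 - inner ℝ x w ^ 2 / (1 + ‖x‖ ^ 2) := fun w => by
    rw [sub_nonneg, div_le_iff₀ hq]
    have hcs : inner ℝ x w ^ 2 ≤ ‖x‖ ^ 2 * ‖w‖ ^ 2 := by
      rw [← mul_pow, sq_le_sq, abs_of_nonneg (a := ‖x‖ * ‖w‖) (by positivity)]
      exact abs_real_inner_le_norm x w
    nlinarith [sq_nonneg ‖w‖]
  -- The vector `n + ⟨x, n⟩ x` is the hyperbolic dual of the covector `n`, and `D` is its squared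
  -- norm: the usual proof of Cauchy-Schwarz.
  have h := hpos (D • X - u • (n + inner ℝ x n • x))
  have h1 : ‖D • X - u • (n + inner ℝ x n • x)‖ ^ 2
      - inner ℝ x (D • X - u • (n + inner ℝ x n • x)) ^ 2 / (1 + ‖x‖ ^ 2)
      = D * (D * (‖X‖ ^ 2 - b ^ 2 / (1 + ‖x‖ ^ 2)) - u ^ 2) := by
    rw [← real_inner_self_eq_norm_sq (D • X - u • (n + inner ℝ x n • x))]
    simp only [inner_sub_left, inner_sub_right, inner_add_left, inner_add_right,
      real_inner_smul_left, real_inner_smul_right]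
    simp only [real_inner_self_eq_norm_sq, real_inner_comm X n, real_inner_comm x X,
      real_inner_comm x n, ← hu, ← hb]
    field_simp
    rw [hD]
    ring
  rw [h1] at h
  have h2 := nonneg_of_mul_nonneg_right h hDpos
  nlinarith

/-! ### Area of hyperbolic balls with respect to `g`. -/

namespace RadialProfile

variable (P : RadialProfile)

lemma hyperbolic_norm_le {x X : E3} (hx : (1 + ‖x‖ ^ 2)⁻¹ ≤ P.F (‖x‖ ^ 2))
    (hX : P.metric.ip x X X ≤ 1) : ‖X‖ ^ 2 - inner ℝ x X ^ 2 / (1 + ‖x‖ ^ 2) ≤ 1 := by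
  refine le_trans ?_ hX
  rw [ip_eq, real_inner_self_eq_norm_sq]
  rcases eq_or_ne x 0 with rfl | hx0
  · simp
  have hq : 0 < ‖x‖ ^ 2 := by positivity
  have : -(1 + ‖x‖ ^ 2)⁻¹ ≤ P.a (‖x‖ ^ 2) := by
    refine le_of_mul_le_mul_right ?_ hq
    rw [F] at hx
    have : -(1 + ‖x‖ ^ 2)⁻¹ * ‖x‖ ^ 2 = (1 + ‖x‖ ^ 2)⁻¹ - 1 := by field_simp; ring
    linarith
  rw [div_eq_mul_inv]
  nlinarith [sq_nonneg (inner ℝ x X)]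

/-- The `g`-area of the boundary of a hyperbolic ball, compared with its hyperbolic area. -/
lemma setIntegral_hypBall_eDiv_le {t ρ κ : ℝ} (hρ : 0 < ρ)
    (hF : ∀ x ∈ hypBall t ρ, (1 + ‖x‖ ^ 2)⁻¹ ≤ P.F (‖x‖ ^ 2))
    (hκ : ∀ x ∈ hypBall t ρ, P.metric.dens x * lorentz x ≤ κ)
    {X : E3 → E3} (hX : ContDiff ℝ 1 X) (h1 : ∀ x, P.metric.ip x (X x) (X x) ≤ 1) :
    ∫ x in hypBall t ρ, eDiv (fun y => P.metric.dens y • X y) x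
      ≤ 4 * Real.pi * Real.sinh ρ ^ 2 * κ := by
  set Y : E3 → E3 := fun y => P.metric.dens y • X y with hY
  have hYs : ContDiff ℝ 1 Y := P.contDiff_dens_smul hX
  set c := Real.cosh t with hc
  have hchart : ContDiff ℝ 1 (ballChart t ρ) :=
    contDiff_id.add (((contDiff_const.mul ((coord_smooth 0).of_le (mod_cast le_top))).add
      contDiff_const).smul contDiff_const)
  -- The Piola transform of `Y`: the cofactor matrix of `diag(c, 1, 1)` applied to `Y`, so that
  -- divergences correspond up to the Jacobian `c`.
  let Z : E3 → E3 := fun y => c • Y (ballChart t ρ y) + ((1 - c) * Y (ballChart t ρ y) 0) • e₀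
  have hYc : ContDiff ℝ 1 (fun y => Y (ballChart t ρ y)) := hYs.comp hchart
  have hZs : ContDiff ℝ 1 Z := (hYc.const_smul c).add
    ((contDiff_const.mul (((coord_smooth 0).of_le (mod_cast le_top)).comp hYc)).smul
      contDiff_const)
  have hdiv : ∀ y, eDiv Z y = c * eDiv Y (ballChart t ρ y) := fun y => by
    rw [eDiv_eq_sum_fderiv (hZs.differentiable one_ne_zero y),
      eDiv_eq_sum_fderiv (hYs.differentiable one_ne_zero _)]
    set M := fderiv ℝ Y (ballChart t ρ y) with hM
    have h2 : HasFDerivAt (fun y => Y (ballChart t ρ y)) (M.comp (ContinuousLinearMap.id ℝ E3 +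
      ((c - 1) • (EuclideanSpace.proj (𝕜 := ℝ) 0 : E3 →L[ℝ] ℝ)).smulRight e₀)) y :=
      (hYs.differentiable one_ne_zero _).hasFDerivAt.comp y (hasFDerivAt_ballChart t ρ y)
    have h3 := (h2.const_smul c).add (((((hasFDerivAt_coord 0 _).comp y h2).const_mul
      (1 - c))).smul_const e₀)
    have h4 : fderiv ℝ Z y = _ := h3.fderiv
    rw [h4, Fin.sum_univ_three, Fin.sum_univ_three]
    simp
    ring
  have hS : 0 < Real.sinh ρ := Real.sinh_pos_iff.2 hρ
  rw [setIntegral_hypBall]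
  simp only [← hc, ← hdiv]
  refine setIntegral_eDiv_closedBall_le hZs hS fun y hy => ?_
  set x := ballChart t ρ y with hx
  have hxE : x ∈ hypBall t ρ := ⟨y, by rw [mem_closedBall_zero_iff, hy], rfl⟩
  -- The transported conormal. Its hyperbolic dual norm is `sinh ρ` times the Lorentz factor, and
  -- `κ` bounds the ratio of the volume density of `g` to the hyperbolic one.
  set n : E3 := c • y + ((1 - c) * y 0) • e₀ with hn
  have hZn : inner ℝ (Z y) y = P.metric.dens x * inner ℝ (X x) n := by
    simp only [Z, hY, hn, inner_eq_sum, ← hx]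
    simp
    ring
  have hn2 : ‖n‖ ^ 2 + inner ℝ x n ^ 2 = (Real.sinh ρ * lorentz x) ^ 2 := by
    have h5 := one_add_norm_sq_ballChart t ρ y
    rw [← hx, ← lorentz_sq, hy, sub_self, add_zero] at h5
    rw [mul_pow, h5, norm_sq_eq_sum, inner_eq_sum, hx, ballChart_zero, ballChart_one,
      ballChart_two]
    have hn0 : n 0 = y 0 := by simp [hn]; ring
    have hn1 : n 1 = c * y 1 := by simp [hn]
    have hn3 : n 2 = c * y 2 := by simp [hn]
    rw [hn0, hn1, hn3, ← hc]
    have hyS : Real.sinh ρ ^ 2 = y 0 ^ 2 + y 1 ^ 2 + y 2 ^ 2 := by rw [← hy, norm_sq_eq_sum]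
    have hCt : c ^ 2 = Real.sinh t ^ 2 + 1 := Real.cosh_sq t
    have hCρ : Real.cosh ρ ^ 2 = Real.sinh ρ ^ 2 + 1 := Real.cosh_sq ρ
    have hw : y 1 ^ 2 + y 2 ^ 2 = Real.sinh ρ ^ 2 - y 0 ^ 2 := by linarith
    have e1 : y 0 ^ 2 + (c * y 1) ^ 2 + (c * y 2) ^ 2
        = y 0 ^ 2 + c ^ 2 * (Real.sinh ρ ^ 2 - y 0 ^ 2) := by rw [← hw]; ring
    have e2 : (c * y 0 + Real.cosh ρ * Real.sinh t) * y 0 + y 1 * (c * y 1) + y 2 * (c * y 2)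
        = Real.cosh ρ * Real.sinh t * y 0 + c * Real.sinh ρ ^ 2 := by
      linear_combination c * hw
    rw [e1, e2]
    linear_combination (-y 0 ^ 2) * hCt + (Real.sinh t ^ 2 * y 0 ^ 2 - c ^ 2 * Real.sinh ρ ^ 2) * hCρ
  have hle : inner ℝ (X x) n ≤ Real.sinh ρ * lorentz x := by
    refine le_of_sq_le_sq ?_ (mul_nonneg hS.le (lorentz_pos x).le)
    rw [← hn2]
    exact inner_sq_le_of_hyperbolic (P.hyperbolic_norm_le (hF x hxE) (h1 x))
  rw [hZn]
  calc P.metric.dens x * inner ℝ (X x) n ≤ P.metric.dens x * (Real.sinh ρ * lorentz x) :=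
        mul_le_mul_of_nonneg_left hle (P.dens_pos x).le
    _ = P.metric.dens x * lorentz x * Real.sinh ρ := by ring
    _ ≤ κ * Real.sinh ρ := mul_le_mul_of_nonneg_right (hκ x hxE) hS.le

end RadialProfile

/-! ### The explicit perturbation. -/

/-- The radial coefficient of the Schwarzschild-anti-de Sitter metric, as a function of
`q = |x|²`. -/
def schwarzschildF (m q : ℝ) : ℝ := (1 + q - 2 * m / √q)⁻¹

/-- The coefficient of `(x · dx)²` near the horizon, where the radial coefficient is `q⁻⁴`. -/
def horizonCoeff (q : ℝ) : ℝ := Real.smoothTransition (4 * q - 2) * (((q ^ 4)⁻¹ - 1) / q)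

/-- The coefficient of `(x · dx)²` near infinity. -/
def endCoeff (m q₁ q : ℝ) : ℝ := Real.smoothTransition (q - q₁) * ((schwarzschildF m q - 1) / q)

lemma smoothTransition_affine (a b : ℝ) :
    ContDiff ℝ ∞ (fun q : ℝ => Real.smoothTransition (a * q - b)) :=
  Real.smoothTransition.contDiff.comp ((contDiff_const.mul contDiff_id).sub contDiff_const)

lemma horizonCoeff_smooth : ContDiff ℝ ∞ horizonCoeff := by
  rw [contDiff_iff_contDiffAt]
  intro q
  rcases lt_or_ge q (1 / 2) with h | h
  · have : horizonCoeff =ᶠ[𝓝 q] fun _ => 0 := by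
      filter_upwards [Iio_mem_nhds h] with z hz
      rw [horizonCoeff, Real.smoothTransition.zero_of_nonpos (by linarith [mem_Iio.1 hz]), zero_mul]
    exact contDiffAt_const.congr_of_eventuallyEq this
  · have hq : q ≠ 0 := by linarith
    exact (smoothTransition_affine 4 2).contDiffAt.mul
      ((((contDiffAt_id.pow 4).inv (pow_ne_zero 4 hq)).sub contDiffAt_const).div contDiffAt_id hq)

/-- The hypothesis gives `s > 2m`, so the mass term is less than `1`. This yields both positivity of
the Schwarzschild coefficient and its upper bound `1/q`. -/
lemma lt_schwarzschild_denom {m q : ℝ} (hq : 4 * m ^ 2 < q) :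
    q < 1 + q - 2 * m / √q := by
  have h0 : 0 < √q := Real.sqrt_pos.2 (by nlinarith)
  have h1 : 2 * m < √q := Real.lt_sqrt_of_sq_lt (by nlinarith)
  have : 2 * m / √q < 1 := (div_lt_one h0).2 h1
  linarith

lemma endCoeff_smooth {m q₁ : ℝ} (hq₁ : 4 * m ^ 2 + 5 ≤ q₁) :
    ContDiff ℝ ∞ (endCoeff m q₁) := by
  rw [contDiff_iff_contDiffAt]
  intro q
  rcases lt_or_ge q q₁ with h | h
  · have : endCoeff m q₁ =ᶠ[𝓝 q] fun _ => 0 := by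
      filter_upwards [Iio_mem_nhds h] with z hz
      rw [endCoeff, Real.smoothTransition.zero_of_nonpos (by linarith [mem_Iio.1 hz]), zero_mul]
    exact contDiffAt_const.congr_of_eventuallyEq this
  · have hq : 0 < q := by nlinarith
    have hden := lt_schwarzschild_denom (show 4 * m ^ 2 < q by linarith)
    have hsq : ContDiffAt ℝ ∞ Real.sqrt q := Real.contDiffAt_sqrt hq.ne'
    have hst : ContDiffAt ℝ ∞ (fun q : ℝ => Real.smoothTransition (q - q₁)) q := by
      simpa using (smoothTransition_affine 1 q₁).contDiffAt (x := q)
    refine hst.mul (((ContDiffAt.inv ?_ (by linarith)).sub contDiffAt_const).div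
      contDiffAt_id hq.ne')
    exact (contDiffAt_const.add contDiffAt_id).sub
      (contDiffAt_const.div hsq (Real.sqrt_pos.2 hq).ne')

/-- The coefficient of `(x · dx)²`: it interpolates between the horizon and the end. -/
def perturbationCoeff (m q₁ q : ℝ) : ℝ :=
  (1 - Real.smoothTransition (q - q₁)) * horizonCoeff q + endCoeff m q₁ q

lemma perturbationCoeff_radial {m q₁ q : ℝ} (hq : 0 < q) :
    1 + perturbationCoeff m q₁ q * q = (1 - Real.smoothTransition (q - q₁)) *
      (1 + Real.smoothTransition (4 * q - 2) * ((q ^ 4)⁻¹ - 1))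
      + Real.smoothTransition (q - q₁) * schwarzschildF m q := by
  rw [perturbationCoeff, horizonCoeff, endCoeff]
  field_simp
  ring

lemma perturbationCoeff_pos {m q₁ : ℝ} (hq₁ : 4 * m ^ 2 + 5 ≤ q₁) (q : ℝ)
    (hq : 0 ≤ q) : 0 < 1 + perturbationCoeff m q₁ q * q := by
  rcases hq.eq_or_lt with rfl | hq
  · simp
  rw [perturbationCoeff_radial hq]
  have h1 : 0 < 1 + Real.smoothTransition (4 * q - 2) * ((q ^ 4)⁻¹ - 1) := by
    have h2 := Real.smoothTransition.nonneg (4 * q - 2)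
    have h3 := Real.smoothTransition.le_one (4 * q - 2)
    have h4 : 0 < (q ^ 4)⁻¹ := by positivity
    rcases h2.eq_or_lt with h | h
    · rw [← h]; simp
    · nlinarith
  rcases le_or_gt q q₁ with h | h
  · rw [Real.smoothTransition.zero_of_nonpos (by linarith)]
    simpa using h1
  · have h5 := Real.smoothTransition.pos_of_pos (show 0 < q - q₁ by linarith)
    have h6 := Real.smoothTransition.le_one (q - q₁)
    have h7 : 0 < schwarzschildF m q :=
      inv_pos.2 (hq.trans (lt_schwarzschild_denom (by linarith)))
    have := mul_nonneg (sub_nonneg.2 h6) h1.le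
    have := mul_pos h5 h7
    linarith

/-- A rotationally symmetric perturbation of Schwarzschild-anti-de Sitter space, unperturbed where
`|x|² ≥ q₁ + 1`. -/
def perturbation {m q₁ : ℝ} (hq₁ : 4 * m ^ 2 + 5 ≤ q₁) : RadialProfile where
  a := perturbationCoeff m q₁
  smooth := ((contDiff_const.sub (by simpa using smoothTransition_affine 1 q₁)).mul
    horizonCoeff_smooth).add (endCoeff_smooth hq₁)
  pos := perturbationCoeff_pos hq₁

lemma perturbation_F_eq {m q₁ : ℝ} (hq₁ : 4 * m ^ 2 + 5 ≤ q₁)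
    {q : ℝ} (hq : 1 ≤ q) : (perturbation hq₁).F q =
    (1 - Real.smoothTransition (q - q₁)) * (q ^ 4)⁻¹
      + Real.smoothTransition (q - q₁) * schwarzschildF m q := by
  rw [RadialProfile.F]
  refine (perturbationCoeff_radial (by linarith)).trans ?_
  rw [Real.smoothTransition.one_of_one_le (show 1 ≤ 4 * q - 2 by linarith)]
  ring

lemma perturbation_F_one {m q₁ : ℝ} (hq₁ : 4 * m ^ 2 + 5 ≤ q₁)
    : (perturbation hq₁).F 1 = 1 := by
  rw [perturbation_F_eq hq₁ le_rfl, Real.smoothTransition.zero_of_nonpos (by nlinarith)]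
  simp

/-- Both `q⁻⁴` and the Schwarzschild coefficient, where it enters, are below `1/q`, and `F` is a
convex combination of them. This makes the mean curvature of larger spheres exceed `2`. -/
lemma perturbation_F_lt {m q₁ : ℝ} (hq₁ : 4 * m ^ 2 + 5 ≤ q₁)
    {q : ℝ} (hq : 1 < q) : (perturbation hq₁).F q < 1 / q := by
  rw [perturbation_F_eq hq₁ hq.le, one_div]
  have h0 : (q ^ 4)⁻¹ < q⁻¹ := by
    apply inv_strictAnti₀ (by linarith)
    nlinarith [pow_lt_pow_right₀ hq (show 1 < 4 by norm_num)]
  rcases le_or_gt q q₁ with h | h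
  · rw [Real.smoothTransition.zero_of_nonpos (by linarith)]
    simpa using h0
  · have h5 := Real.smoothTransition.pos_of_pos (show 0 < q - q₁ by linarith)
    have h6 := Real.smoothTransition.le_one (q - q₁)
    have h7 : schwarzschildF m q < q⁻¹ :=
      inv_strictAnti₀ (by linarith) (lt_schwarzschild_denom (by linarith))
    nlinarith

lemma perturbation_F_end {m q₁ : ℝ} (hq₁ : 4 * m ^ 2 + 5 ≤ q₁)
    {q : ℝ} (hq : q₁ + 1 ≤ q) :
    (perturbation hq₁).F q = schwarzschildF m q := by
  rw [perturbation_F_eq hq₁ (by nlinarith),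
    Real.smoothTransition.one_of_one_le (by linarith)]
  ring

lemma inv_one_add_le_schwarzschildF {m : ℝ} (hm : 0 < m)
    {q : ℝ} (hq : 4 * m ^ 2 < q) :
    (1 + q)⁻¹ ≤ schwarzschildF m q := by
  have h0 : 0 < q := by nlinarith
  apply inv_anti₀ (h0.trans (lt_schwarzschild_denom hq))
  have : 0 ≤ 2 * m / √q := by positivity
  linarith

lemma inv_one_add_le_perturbation_F {m q₁ : ℝ} (hm : 0 < m) (hq₁ : 4 * m ^ 2 + 5 ≤ q₁)
    {q : ℝ} (hq : q₁ + 1 ≤ q) :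
    (1 + q)⁻¹ ≤ (perturbation hq₁).F q := by
  rw [perturbation_F_end hq₁ hq]
  exact inv_one_add_le_schwarzschildF hm (by linarith)

lemma perturbation_coeff_end {m q₁ : ℝ} (hq₁ : 4 * m ^ 2 + 5 ≤ q₁)
    {x : E3} (hx : q₁ + 1 ≤ ‖x‖ ^ 2) :
    (perturbation hq₁).metric.coeff x = schwarzschildAdS m x := by
  have hq : 0 < ‖x‖ ^ 2 := by nlinarith
  have hn : 0 < ‖x‖ := by
    by_contra! h
    have := le_antisymm h (norm_nonneg x)
    rw [this] at hq; simp at hq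
  have hF := perturbation_F_end hq₁ hx
  rw [RadialProfile.F, schwarzschildF, Real.sqrt_sq hn.le] at hF
  have ha : (perturbation hq₁).a (‖x‖ ^ 2)
      = ((1 + ‖x‖ ^ 2 - 2 * m / ‖x‖)⁻¹ - 1) / ‖x‖ ^ 2 := by
    rw [eq_div_iff hq.ne']; linarith
  ext i j
  simp only [RadialProfile.metric, RadialProfile.coeff, schwarzschildAdS, Matrix.of_apply, ha]
  generalize (1 + ‖x‖ ^ 2 - 2 * m / ‖x‖)⁻¹ = w
  field_simp
  ring

/-- The `5` in the bound on `q₁` keeps a neighborhood of `q = 4` in the region where `F = q⁻⁴`. -/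
lemma perturbation_scal_lt {m q₁ : ℝ} (hq₁ : 4 * m ^ 2 + 5 ≤ q₁)
    :
    (perturbation hq₁).metric.scal (EuclideanSpace.single 0 2) < -6 := by
  apply RadialProfile.scal_lt
  filter_upwards [Ioo_mem_nhds (show (1 : ℝ) < 4 by norm_num) (show (4 : ℝ) < 5 by norm_num)]
    with q hq
  show perturbationCoeff m q₁ q = _
  rw [perturbationCoeff, horizonCoeff, endCoeff,
    Real.smoothTransition.zero_of_nonpos (show q - q₁ ≤ 0 by nlinarith [hq.2]),
    Real.smoothTransition.one_of_one_le (show 1 ≤ 4 * q - 2 by linarith [hq.1])]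
  ring

lemma two_mul_lt_norm {m q₁ : ℝ} (hq₁ : 4 * m ^ 2 + 5 ≤ q₁)
    {x : E3} (hx : q₁ ≤ ‖x‖ ^ 2) : 2 * m < ‖x‖ :=
  lt_of_pow_lt_pow_left₀ 2 (norm_nonneg x) (by nlinarith)

/-! ### Comparison of volumes with hyperbolic volumes. -/

lemma sqrt_schwarzschildF_le {m q₁ : ℝ} (hm : 0 < m) (hq₁ : 4 * m ^ 2 + 5 ≤ q₁)
    {x : E3} (hx : q₁ ≤ ‖x‖ ^ 2) :
    √(schwarzschildF m (‖x‖ ^ 2)) ≤ (lorentz x)⁻¹ + m * (‖x‖ ^ 4)⁻¹ := by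
  have hs := two_mul_lt_norm hq₁ hx
  have hs0 : 0 < ‖x‖ := by linarith
  have hG := lt_schwarzschild_denom (show 4 * m ^ 2 < ‖x‖ ^ 2 by linarith)
  rw [Real.sqrt_sq hs0.le] at hG
  rw [schwarzschildF, Real.sqrt_inv, Real.sqrt_sq hs0.le]
  set w := √(1 + ‖x‖ ^ 2 - 2 * m / ‖x‖) with hw
  have hw2 : w ^ 2 = 1 + ‖x‖ ^ 2 - 2 * m / ‖x‖ := Real.sq_sqrt (by nlinarith)
  have hws : ‖x‖ ≤ w := Real.le_sqrt_of_sq_le hG.le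
  have hL2 := lorentz_sq x
  have hLs : ‖x‖ ≤ lorentz x := Real.le_sqrt_of_sq_le (by linarith)
  set L := lorentz x
  have h1 : (L - w) * (L + w) = 2 * m / ‖x‖ := by nlinarith
  have h2 : L - w ≤ m / ‖x‖ ^ 2 := by
    have h3 : 0 ≤ L - w := by
      have : 0 < 2 * m / ‖x‖ := by positivity
      by_contra! h
      nlinarith
    rw [le_div_iff₀ (by positivity)]
    have h4 : (L - w) * (2 * ‖x‖) ≤ 2 * m / ‖x‖ := by
      rw [← h1]; exact mul_le_mul_of_nonneg_left (by linarith) h3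
    rw [le_div_iff₀ hs0] at h4
    nlinarith
  have hL0 : 0 < L := by linarith
  have hw0 : 0 < w := by linarith
  have h5 : w⁻¹ = L⁻¹ + (L - w) / (L * w) := by field_simp; ring
  rw [h5]
  have h6 : (L - w) / (L * w) ≤ (m / ‖x‖ ^ 2) / (‖x‖ * ‖x‖) := by gcongr
  have h7 : (m / ‖x‖ ^ 2) / (‖x‖ * ‖x‖) = m * (‖x‖ ^ 4)⁻¹ := by field_simp
  linarith

lemma dens_mul_lorentz_le {m q₁ : ℝ} (hm : 0 < m) (hq₁ : 4 * m ^ 2 + 5 ≤ q₁)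
    {x : E3} (hx : q₁ + 1 ≤ ‖x‖ ^ 2) :
    (perturbation hq₁).metric.dens x * lorentz x ≤ 1 + 2 * m / ‖x‖ := by
  have h1 : 1 < ‖x‖ := lt_of_pow_lt_pow_left₀ 2 (norm_nonneg x) (by nlinarith)
  rw [RadialProfile.dens_eq, perturbation_F_end hq₁ hx]
  have hL := lorentz_pos x
  have h2 : lorentz x ≤ 2 * ‖x‖ :=
    le_of_sq_le_sq (by rw [lorentz_sq]; nlinarith) (by positivity)
  calc _ ≤ ((lorentz x)⁻¹ + m * (‖x‖ ^ 4)⁻¹) * lorentz x :=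
        mul_le_mul_of_nonneg_right (sqrt_schwarzschildF_le hm hq₁ (by linarith)) hL.le
    _ = 1 + m * (‖x‖ ^ 4)⁻¹ * lorentz x := by field_simp
    _ ≤ 1 + m * (‖x‖ ^ 4)⁻¹ * (2 * ‖x‖) := by gcongr
    _ = 1 + 2 * m / ‖x‖ ^ 3 := by field_simp
    _ ≤ 1 + 2 * m / ‖x‖ := by
        gcongr
        exact le_self_pow₀ h1.le (by norm_num)

/-- The point is that the first term is integrable near infinity and does not depend on `q₁`: the
`1` accounts for `√(q⁻⁴)`, the `m` for the Schwarzschild correction. -/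
lemma dens_le {m q₁ : ℝ} (hm : 0 < m) (hq₁ : 4 * m ^ 2 + 5 ≤ q₁)
    {x : E3} (hx : 1 ≤ ‖x‖) : (perturbation hq₁).metric.dens x ≤
    (1 + m) * (‖x‖ ^ 4)⁻¹ + {x : E3 | q₁ ≤ ‖x‖ ^ 2}.indicator (fun x => (lorentz x)⁻¹) x := by
  have hq : 1 ≤ ‖x‖ ^ 2 := one_le_pow₀ hx
  have hs : √(((‖x‖ ^ 2) ^ 4)⁻¹) = (‖x‖ ^ 4)⁻¹ := by
    rw [show (‖x‖ ^ 2) ^ 4 = (‖x‖ ^ 4) ^ 2 by ring, ← inv_pow, Real.sqrt_sq (by positivity)]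
  have hp : 0 < (‖x‖ ^ 4)⁻¹ := by positivity
  rw [RadialProfile.dens_eq, perturbation_F_eq hq₁ hq]
  by_cases h : q₁ ≤ ‖x‖ ^ 2
  · rw [indicator_of_mem (by exact h)]
    have h5 := Real.smoothTransition.nonneg (‖x‖ ^ 2 - q₁)
    have h6 := Real.smoothTransition.le_one (‖x‖ ^ 2 - q₁)
    have h7 : 0 < schwarzschildF m (‖x‖ ^ 2) :=
      inv_pos.2 ((by linarith : (0 : ℝ) < ‖x‖ ^ 2).trans
        (lt_schwarzschild_denom (by linarith)))
    have h8 : 0 < ((‖x‖ ^ 2) ^ 4)⁻¹ := by positivity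
    calc _ ≤ √(((‖x‖ ^ 2) ^ 4)⁻¹ + schwarzschildF m (‖x‖ ^ 2)) := by
          apply Real.sqrt_le_sqrt
          nlinarith
      _ ≤ √(((‖x‖ ^ 2) ^ 4)⁻¹) + √(schwarzschildF m (‖x‖ ^ 2)) :=
          Real.sqrt_le_iff.2 ⟨by positivity, by
            nlinarith [Real.sq_sqrt h8.le, Real.sq_sqrt h7.le,
              mul_nonneg (Real.sqrt_nonneg (((‖x‖ ^ 2) ^ 4)⁻¹))
                (Real.sqrt_nonneg (schwarzschildF m (‖x‖ ^ 2)))]⟩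
      _ ≤ _ := by
          rw [hs]
          have := sqrt_schwarzschildF_le hm hq₁ h
          linarith
  · rw [indicator_of_notMem (by exact h),
      Real.smoothTransition.zero_of_nonpos (by linarith [not_le.1 h])]
    simp only [sub_zero, one_mul, zero_mul, add_zero, hs]
    nlinarith

lemma integrableOn_inv_lorentz {s : Set E3} {R : ℝ} (hs : s ⊆ closedBall 0 R) :
    IntegrableOn (fun y : E3 => (lorentz y)⁻¹) s :=
  (continuous_inv_lorentz.continuousOn.integrableOn_compact (isCompact_closedBall _ _)).mono_set hs

lemma integrableOn_inv_norm_pow_four :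
    IntegrableOn (fun x : E3 => (‖x‖ ^ 4)⁻¹) (ball (0 : E3) 1)ᶜ := by
  have h := (integrable_one_add_norm (E := E3) (μ := volume) (r := 4) (by
    rw [finrank_euclideanSpace_fin]; norm_num)).const_mul 16
  refine h.integrableOn.mono' (Measurable.aestronglyMeasurable (by fun_prop)) ?_
  filter_upwards [ae_restrict_mem measurableSet_ball.compl] with x hx
  rw [mem_compl_iff, mem_ball_zero_iff, not_lt] at hx
  rw [norm_inv, norm_pow, norm_norm, Real.rpow_neg (by positivity),
    show (4 : ℝ) = ((4 : ℕ) : ℝ) by norm_num, Real.rpow_natCast, ← div_eq_mul_inv,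
    le_div_iff₀ (by positivity), inv_mul_le_iff₀ (by positivity)]
  calc (1 + ‖x‖) ^ 4 ≤ (2 * ‖x‖) ^ 4 := by gcongr; linarith
    _ = ‖x‖ ^ 4 * 16 := by ring

/-- The hyperbolic volume of thin shells. -/
lemma setIntegral_inv_lorentz_closedBall_le {R S : ℝ} (hS : 2 ≤ S) (hR : 0 ≤ R)
    (hRS : R ^ 2 = S ^ 2 + 2) :
    ∫ y in closedBall (0 : E3) R, (lorentz y)⁻¹
      ≤ (∫ y in closedBall (0 : E3) S, (lorentz y)⁻¹) + 16 / 3 * Real.pi := by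
  have hSR : S ≤ R := le_of_sq_le_sq (by linarith) hR
  have hsub : closedBall (0 : E3) S ⊆ closedBall 0 R := closedBall_subset_closedBall hSR
  have h1 := setIntegral_sdiff measurableSet_closedBall (integrableOn_inv_lorentz subset_rfl) hsub
  -- The density is at most `1/S` in the shell and `R³ - S³ ≤ 4S`, so `S` cancels: lowering the area
  -- by `8π` costs a bounded amount of hyperbolic volume.
  have h2 : ∫ y in closedBall (0 : E3) R \ closedBall 0 S, (lorentz y)⁻¹
      ≤ ∫ y in closedBall (0 : E3) R \ closedBall 0 S, S⁻¹ := by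
    refine setIntegral_mono_on (integrableOn_inv_lorentz sdiff_subset) ?_
      (measurableSet_closedBall.diff measurableSet_closedBall) fun y hy => ?_
    · exact integrableOn_const ((measure_mono sdiff_subset).trans_lt
        measure_closedBall_lt_top).ne
    · have hy' := hy.2
      rw [mem_closedBall_zero_iff, not_le] at hy'
      apply inv_anti₀ (by linarith)
      apply Real.le_sqrt_of_sq_le
      nlinarith
  rw [setIntegral_const, measureReal_sdiff hsub measurableSet_closedBall
      measure_closedBall_lt_top.ne, volume_real_closedBall hR, volume_real_closedBall (by linarith), smul_eq_mul] at h2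
  have h3 : R * S ≤ S ^ 2 + 1 := by
    refine le_of_sq_le_sq ?_ (by positivity)
    rw [mul_pow, hRS]; nlinarith
  have h4 : R ^ 3 - S ^ 3 ≤ 4 * S := by
    have h5 : (R ^ 3 - S ^ 3) * S ≤ 4 * S * S := by
      have : R ^ 3 * S = (R * S) * (S ^ 2 + 2) := by rw [← hRS]; ring
      nlinarith
    exact le_of_mul_le_mul_right h5 (by linarith)
  have h6 : (4 / 3 * Real.pi * R ^ 3 - 4 / 3 * Real.pi * S ^ 3) * S⁻¹ ≤ 16 / 3 * Real.pi := by
    rw [← div_eq_mul_inv, div_le_iff₀ (by linarith)]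
    nlinarith [Real.pi_pos]
  linarith

lemma le_setIntegral_inv_lorentz_closedBall {q : ℝ} (hq : 1 ≤ q) :
    q ≤ ∫ y in closedBall (0 : E3) √q, (lorentz y)⁻¹ := by
  have h0 : 0 < √q := Real.sqrt_pos.2 (by linarith)
  have hsq : √q ^ 2 = q := Real.sq_sqrt (by linarith)
  have h1 : ∫ y in closedBall (0 : E3) √q, (2 * √q)⁻¹
      ≤ ∫ y in closedBall (0 : E3) √q, (lorentz y)⁻¹ := by
    refine setIntegral_mono_on (integrableOn_const measure_closedBall_lt_top.ne)
      (integrableOn_inv_lorentz subset_rfl) measurableSet_closedBall fun y hy => ?_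
    rw [mem_closedBall_zero_iff] at hy
    apply inv_anti₀ (lorentz_pos y)
    refine le_of_sq_le_sq ?_ (by positivity)
    have : ‖y‖ ^ 2 ≤ √q ^ 2 := by gcongr
    rw [lorentz_sq, mul_pow, hsq]
    linarith
  rw [setIntegral_const, volume_real_closedBall h0.le, smul_eq_mul] at h1
  refine le_trans ?_ h1
  have : 4 / 3 * Real.pi * √q ^ 3 * (2 * √q)⁻¹ = 2 / 3 * Real.pi * √q ^ 2 := by
    field_simp; ring
  rw [this, hsq]
  nlinarith [Real.pi_gt_three]

/-- If the perturbation is large enough, then large centered balls have less volume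
than hyperbolic balls of slightly smaller area. -/
lemma exists_volume_deficit {m : ℝ} (hm : 0 < m) : ∃ (q₁ : ℝ) (hq₁ : 4 * m ^ 2 + 5 ≤ q₁),
    ∀ R S : ℝ, 2 ≤ S → 0 ≤ R → R ^ 2 = S ^ 2 + 2 → q₁ ≤ R ^ 2 →
      ∫ x in closedBall (0 : E3) R \ ball 0 1, (perturbation hq₁).metric.dens x
        < ∫ y in closedBall (0 : E3) S, (lorentz y)⁻¹ := by
  set c := ∫ x in (ball (0 : E3) 1)ᶜ, (1 + m) * (‖x‖ ^ 4)⁻¹ with hc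
  -- The hyperbolic volume missing below radius `√q₁`, at least `q₁`, has to beat both the bounded
  -- excess `c` and the shell volume `16π/3`.
  refine ⟨max (4 * m ^ 2 + 5) (c + 16 / 3 * Real.pi + 1), le_max_left _ _,
    fun R S hS hR hRS hqR => ?_⟩
  set q₁ := max (4 * m ^ 2 + 5) (c + 16 / 3 * Real.pi + 1)
  have hq₁ : 4 * m ^ 2 + 5 ≤ q₁ := le_max_left _ _
  have hcq : c + 16 / 3 * Real.pi + 1 ≤ q₁ := le_max_right _ _
  have h1q : 1 ≤ q₁ := by nlinarith
  have hsq : √q₁ ^ 2 = q₁ := Real.sq_sqrt (by linarith)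
  have hsqR : √q₁ ≤ R := le_of_sq_le_sq (by rw [hsq]; exact hqR) hR
  have hint4 : IntegrableOn (fun x : E3 => (1 + m) * (‖x‖ ^ 4)⁻¹) (ball (0 : E3) 1)ᶜ :=
    integrableOn_inv_norm_pow_four.const_mul (1 + m)
  have hmeasE : MeasurableSet {x : E3 | q₁ ≤ ‖x‖ ^ 2} :=
    (isClosed_le continuous_const (by fun_prop)).measurableSet
  have hintR : IntegrableOn (fun y : E3 => (lorentz y)⁻¹) (closedBall 0 R) :=
    integrableOn_inv_lorentz subset_rfl
  have hm0 : MeasurableSet (closedBall (0 : E3) R \ ball 0 1) :=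
    measurableSet_closedBall.diff measurableSet_ball
  have h1 : ∫ x in closedBall (0 : E3) R \ ball 0 1, (perturbation hq₁).metric.dens x
      ≤ ∫ x in closedBall (0 : E3) R \ ball 0 1, ((1 + m) * (‖x‖ ^ 4)⁻¹
        + {x : E3 | q₁ ≤ ‖x‖ ^ 2}.indicator (fun x => (lorentz x)⁻¹) x) := by
    refine setIntegral_mono_on ?_ ((hint4.mono_set fun x hx => hx.2).add
      ((hintR.indicator hmeasE).mono_set sdiff_subset)) hm0 fun x hx => ?_
    · exact (((perturbation hq₁).dens_smooth.continuous.continuousOn).integrableOn_compact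
        (isCompact_closedBall _ _)).mono_set sdiff_subset
    · have := hx.2
      rw [mem_ball_zero_iff, not_lt] at this
      exact dens_le hm hq₁ this
  rw [integral_add (hint4.mono_set fun x hx => hx.2)
    ((hintR.indicator hmeasE).mono_set sdiff_subset)] at h1
  have h2 : ∫ x in closedBall (0 : E3) R \ ball 0 1, (1 + m) * (‖x‖ ^ 4)⁻¹ ≤ c :=
    setIntegral_mono_set hint4 (ae_of_all _ fun x => by positivity)
      (LE.le.eventuallyLE fun x hx => hx.2)
  have h3 : ∫ x in closedBall (0 : E3) R \ ball 0 1,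
      {x : E3 | q₁ ≤ ‖x‖ ^ 2}.indicator (fun x => (lorentz x)⁻¹) x
      ≤ ∫ x in closedBall (0 : E3) R \ ball 0 √q₁, (lorentz x)⁻¹ := by
    rw [setIntegral_indicator hmeasE]
    refine setIntegral_mono_set (hintR.mono_set sdiff_subset)
      (ae_of_all _ fun x => (inv_pos.2 (lorentz_pos x)).le)
      (LE.le.eventuallyLE fun x hx => ⟨hx.1.1, fun h => ?_⟩)
    rw [mem_ball_zero_iff] at h
    have h' : ‖x‖ ^ 2 < √q₁ ^ 2 := by gcongr
    rw [hsq] at h'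
    exact absurd hx.2 (not_le.2 h')
  rw [setIntegral_sdiff measurableSet_ball hintR
    (ball_subset_closedBall.trans (closedBall_subset_closedBall hsqR)),
    ← setIntegral_closedBall_eq_ball] at h3
  have h4 := setIntegral_inv_lorentz_closedBall_le hS hR hRS
  have h5 := le_setIntegral_inv_lorentz_closedBall h1q
  linarith

/-! ### The off-center competitor. -/

lemma setIntegral_hypBall_zero (t : ℝ) (f : E3 → ℝ) : ∫ x in hypBall t 0, f x = 0 := by
  rw [setIntegral_hypBall, Real.sinh_zero, closedBall_zero]
  simp

/-- Rescaling to a fixed domain turns continuity of the volume in `ρ` into continuity of a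
parametric integral. -/
lemma setIntegral_hypBall_eq (t : ℝ) {ρ : ℝ} (hρ : 0 ≤ ρ) (f : E3 → ℝ) :
    ∫ x in hypBall t ρ, f x = ∫ y in closedBall (0 : E3) 1,
      Real.sinh ρ ^ 3 * (Real.cosh t * f (ballChart t ρ (Real.sinh ρ • y))) := by
  rcases hρ.eq_or_lt with rfl | hρ
  · rw [setIntegral_hypBall_zero]; simp
  have hS : 0 < Real.sinh ρ := Real.sinh_pos_iff.2 hρ
  rw [setIntegral_hypBall, integral_const_mul (Real.sinh ρ ^ 3)]
  have h := Measure.setIntegral_comp_smul_of_pos (volume : Measure E3)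
    (fun y => Real.cosh t * f (ballChart t ρ y)) (closedBall (0 : E3) 1) hS
  rw [h, smul_unitClosedBall_of_nonneg hS.le, finrank_euclideanSpace_fin, smul_eq_mul,
    mul_inv_cancel_left₀ (pow_ne_zero 3 hS.ne')]

lemma continuous_hypBall_integral (t : ℝ) {f : E3 → ℝ} (hf : Continuous f) :
    Continuous fun ρ => ∫ y in closedBall (0 : E3) 1,
      Real.sinh ρ ^ 3 * (Real.cosh t * f (ballChart t ρ (Real.sinh ρ • y))) := by
  refine continuous_parametric_integral_of_continuous ?_ (isCompact_closedBall _ _)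
  unfold ballChart Function.uncurry
  fun_prop

namespace RadialProfile

variable (P : RadialProfile)

lemma perimeter_ball_union_hypBall_le {t ρ κ : ℝ} (hρ : 0 ≤ ρ)
    (hdisj : Disjoint (ball (0 : E3) 1) (hypBall t ρ))
    (hF : ∀ x ∈ hypBall t ρ, (1 + ‖x‖ ^ 2)⁻¹ ≤ P.F (‖x‖ ^ 2))
    (hκ : ∀ x ∈ hypBall t ρ, P.metric.dens x * lorentz x ≤ κ) :
    perimeter P.metric (ball 0 1 ∪ hypBall t ρ)
      ≤ ENNReal.ofReal (4 * Real.pi * (1 + Real.sinh ρ ^ 2 * κ)) := by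
  refine iSup₂_le fun X hX => ?_
  rw [P.setIntegral_div (measurableSet_ball.union (measurableSet_hypBall t ρ))]
  apply ENNReal.ofReal_le_ofReal
  have hc := continuous_eDiv (P.contDiff_dens_smul hX.1)
  rw [setIntegral_union hdisj (measurableSet_hypBall t ρ)
    ((hc.continuousOn.integrableOn_compact (isCompact_closedBall _ _)).mono_set
      ball_subset_closedBall)
    (hc.continuousOn.integrableOn_compact (isCompact_hypBall t ρ)),
    ← setIntegral_closedBall_eq_ball]
  have h1 := P.setIntegral_closedBall_div_le hX.1 hX.2.2 one_pos
  have h2 : ∫ x in hypBall t ρ, eDiv (fun y => P.metric.dens y • X y) x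
      ≤ 4 * Real.pi * Real.sinh ρ ^ 2 * κ := by
    rcases hρ.eq_or_lt with rfl | hρ
    · rw [setIntegral_hypBall_zero]; simp
    · exact P.setIntegral_hypBall_eDiv_le hρ hF hκ hX.1 hX.2.2
  linarith

lemma vol_eq_ofReal_setIntegral {Ω K : Set E3} (hΩ : MeasurableSet Ω) (hK : IsCompact K)
    (hΩK : Ω ⊆ K) :
    P.metric.vol Ω = ENNReal.ofReal (∫ x in Ω, P.metric.dens x) := by
  rw [P.vol_apply hΩ, ofReal_integral_eq_lintegral_ofReal
    ((P.dens_smooth.continuous.continuousOn.integrableOn_compact hK).mono_set hΩK)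
    (ae_of_all _ fun x => (P.dens_pos x).le)]

end RadialProfile

/-- Far out in the end, there are regions of any given volume whose boundary area is close to that
of the corresponding hyperbolic balls. -/
lemma exists_competitor {m q₁ : ℝ} (hm : 0 < m) (hq₁ : 4 * m ^ 2 + 5 ≤ q₁) {S V : ℝ} (hS : 0 ≤ S)
    (hV0 : 0 ≤ V) (hV : V ≤ ∫ y in closedBall (0 : E3) S, (lorentz y)⁻¹) :
    ∃ Ω : Set E3, IsAdmissible (ball 0 1) (perturbation hq₁).metric Ω ∧
      extVolume (ball 0 1) (perturbation hq₁).metric Ω = ENNReal.ofReal V ∧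
      perimeter (perturbation hq₁).metric Ω < ENNReal.ofReal (4 * Real.pi * (S ^ 2 + 2)) := by
  set P := perturbation hq₁ with hP
  set ρ := Real.arsinh S with hρdef
  have hρ : 0 ≤ ρ := Real.arsinh_nonneg_iff.2 hS
  have hsinh : Real.sinh ρ = S := Real.sinh_arsinh S
  -- Large enough to be in the unperturbed region, and more than `2mS²`, so that the area error
  -- factor `1 + 2m/T` adds less than `4π`.
  set T := q₁ + 1 + 2 * m * S ^ 2 with hT
  have hmS : 0 ≤ 2 * m * S ^ 2 := by positivity
  have hqT : q₁ + 1 ≤ T := by linarith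
  have hT1 : 1 < T := by nlinarith
  -- Every ball of radius at most `ρ` about this center stays at coordinate radius at least `T`.
  set t := ρ + T with ht
  have hfar : ∀ ρ' ∈ Icc 0 ρ, ∀ x ∈ hypBall t ρ', T ≤ ‖x‖ := by
    intro ρ' hρ' x hx
    have h1 := le_norm_of_mem_hypBall hx
    have h2 : T ≤ t - ρ' := by linarith [hρ'.2]
    have h3 : t - ρ' ≤ Real.sinh (t - ρ') := Real.self_le_sinh_iff.2 (by linarith)
    linarith
  have hfar2 : ∀ ρ' ∈ Icc 0 ρ, ∀ x ∈ hypBall t ρ', q₁ + 1 ≤ ‖x‖ ^ 2 := by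
    intro ρ' hρ' x hx
    have := hfar ρ' hρ' x hx
    nlinarith
  have hcont := continuous_hypBall_integral t P.dens_smooth.continuous
  have hlow : V ≤ ∫ x in hypBall t ρ, P.metric.dens x := by
    refine hV.trans ?_
    rw [← hsinh]
    refine (le_setIntegral_hypBall_inv_lorentz t hρ).trans ?_
    refine setIntegral_mono_on
      (continuous_inv_lorentz.continuousOn.integrableOn_compact (isCompact_hypBall t ρ))
      (P.dens_smooth.continuous.continuousOn.integrableOn_compact (isCompact_hypBall t ρ))
      (measurableSet_hypBall t ρ) fun x hx => ?_
    rw [P.dens_eq, lorentz, ← Real.sqrt_inv]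
    exact Real.sqrt_le_sqrt
      (inv_one_add_le_perturbation_F hm hq₁ (hfar2 ρ ⟨hρ, le_rfl⟩ x hx))
  rw [setIntegral_hypBall_eq t hρ] at hlow
  -- The ball of radius `ρ` holds at least the volume `V`, so shrinking it matches `V` exactly; `ρ'
  -- = 0` can occur.
  obtain ⟨ρ', hρ', hvol⟩ := intermediate_value_Icc hρ hcont.continuousOn
    (show V ∈ Icc _ _ from ⟨by simpa using hV0, hlow⟩)
  simp only at hvol
  rw [← setIntegral_hypBall_eq t hρ'.1] at hvol
  have hdisj : Disjoint (ball (0 : E3) 1) (hypBall t ρ') := by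
    rw [Set.disjoint_left]
    intro x hx hx'
    rw [mem_ball_zero_iff] at hx
    linarith [hfar ρ' hρ' x hx']
  have hper := P.perimeter_ball_union_hypBall_le (κ := 1 + 2 * m / T) hρ'.1 hdisj
    (fun x hx => inv_one_add_le_perturbation_F hm hq₁ (hfar2 ρ' hρ' x hx))
    (fun x hx => (dens_mul_lorentz_le hm hq₁ (hfar2 ρ' hρ' x hx)).trans (by
      have := hfar ρ' hρ' x hx
      gcongr))
  refine ⟨ball 0 1 ∪ hypBall t ρ',
    ⟨measurableSet_ball.union (measurableSet_hypBall t ρ'), subset_union_left,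
      (hper.trans_lt ENNReal.ofReal_lt_top).ne⟩, ?_, hper.trans_lt ?_⟩
  · rw [extVolume, union_sdiff_left, hdisj.symm.sdiff_eq_left, ← hvol,
      P.vol_eq_ofReal_setIntegral (measurableSet_hypBall t ρ') (isCompact_hypBall t ρ') subset_rfl]
  · have h1 : Real.sinh ρ' ^ 2 ≤ S ^ 2 := by
      rw [← hsinh]
      have := Real.sinh_le_sinh.2 hρ'.2
      have := Real.sinh_nonneg_iff.2 hρ'.1
      gcongr
    have h2 : S ^ 2 * (2 * m / T) < 1 := by
      rw [← mul_div_assoc, div_lt_one (by linarith)]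
      nlinarith
    have h3 : 0 ≤ 2 * m / T := by positivity
    rw [ENNReal.ofReal_lt_ofReal_iff (by positivity)]
    have h4 := mul_le_mul_of_nonneg_right h1 (show 0 ≤ 1 + 2 * m / T by linarith)
    refine mul_lt_mul_of_pos_left ?_ (by positivity)
    linarith

end AdS

end

/-! ### Assembly. -/

theorem mainTheorem4 (m : ℝ) (hm : 0 < m) :
    ∃ (r₀ : ℝ) (φ : ℝ → ℝ) (K : Set AdS.E3) (g : AdS.RMetric),
      0 < r₀ ∧ ContDiff ℝ ∞ φ ∧ (∀ r ∈ Ici r₀, 0 < φ r) ∧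
      AdS.IsWarpedProduct r₀ φ K g ∧
      AdS.IsCompactPerturbation m K g ∧
      (∃ x ∉ closure K, g.scal x < -6) ∧
      ∃ A₀ : ℝ, ∀ A ≥ A₀,
        (∃ B, AdS.IsCenteredBall m K g A B) ∧
        ∀ B, AdS.IsCenteredBall m K g A B → ¬ AdS.IsIsoperimetric K g B := by
  obtain ⟨q₁, hq₁, hdef⟩ := AdS.exists_volume_deficit hm
  have hq₁5 : 5 ≤ q₁ := by nlinarith
  obtain ⟨r₀, φ, hr₀, hφ, hφpos, hwarp⟩ := AdS.RadialProfile.exists_isWarpedProduct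
    fun q hq => AdS.inv_one_add_le_perturbation_F hm hq₁ hq
  have hend : ∀ x : AdS.E3, q₁ + 1 ≤ ‖x‖ ^ 2 → 2 * m ≤ ‖x‖ ∧
      (AdS.perturbation hq₁).metric.coeff x = AdS.schwarzschildAdS m x := fun x hx =>
    ⟨(AdS.two_mul_lt_norm hq₁ (by linarith)).le, AdS.perturbation_coeff_end hq₁ hx⟩
  have hpi := Real.pi_pos
  refine ⟨r₀, φ, ball 0 1, (AdS.perturbation hq₁).metric, hr₀, hφ, hφpos, hwarp,
    ⟨isOpen_ball, isBounded_ball, ⟨closedBall 0 √(q₁ + 1), isCompact_closedBall _ _, ?_, ?_⟩, ?_,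
      AdS.RadialProfile.hasCMCBoundary_unitBall _ (AdS.perturbation_F_one hq₁),
      AdS.RadialProfile.isOutermost_unitBall _ fun q hq => AdS.perturbation_F_lt hq₁ hq⟩,
    ⟨EuclideanSpace.single 0 2, ?_, AdS.perturbation_scal_lt hq₁⟩,
    -- This gives `R² ≥ q₁ + 6`: the sphere lies in the unperturbed region and `S² = R² - 2` is at
    -- least `4`.
    4 * Real.pi * (q₁ + 6), fun A hA => ⟨?_, ?_⟩⟩
  · exact ball_subset_closedBall.trans
      (closedBall_subset_closedBall (Real.one_le_sqrt.2 (by linarith)))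
  · intro x hx
    rw [mem_closedBall_zero_iff, not_le] at hx
    exact hend x ((Real.sqrt_lt' (by linarith [Real.sqrt_nonneg (q₁ + 1)])).1 hx).le
  · rw [frontier_ball _ one_ne_zero]
    refine isConnected_sphere ?_ 0 zero_le_one
    rw [← Module.finrank_eq_rank, finrank_euclideanSpace_fin]
    norm_num
  · rw [closure_ball _ one_ne_zero, mem_closedBall_zero_iff]
    simp
  · have hAp : 0 < A := lt_of_lt_of_le (by positivity) hA
    have hR2 : √(A / (4 * Real.pi)) ^ 2 = A / (4 * Real.pi) := Real.sq_sqrt (by positivity)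
    have hR : 0 < √(A / (4 * Real.pi)) := Real.sqrt_pos.2 (by positivity)
    have hRq : q₁ + 6 ≤ √(A / (4 * Real.pi)) ^ 2 := by
      rw [hR2, le_div_iff₀ (by positivity)]; linarith
    refine ⟨_, _, hR, rfl, fun x hx => ?_, ?_⟩
    · have h1 : √(A / (4 * Real.pi)) ^ 2 ≤ ‖x‖ ^ 2 := by gcongr
      refine ⟨?_, hend x (by linarith)⟩
      rw [mem_ball_zero_iff]
      intro h
      nlinarith [norm_nonneg x]
    · rw [AdS.RadialProfile.perimeter_closedBall _ hR, hR2]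
      congr 1
      field_simp
  · rintro B ⟨R, hR, rfl, -, hper⟩ ⟨-, hiso⟩
    have hAp : 0 < A := lt_of_lt_of_le (by positivity) hA
    have hRA : 4 * Real.pi * R ^ 2 = A := by
      rw [AdS.RadialProfile.perimeter_closedBall _ hR] at hper
      exact (ENNReal.ofReal_eq_ofReal_iff (by positivity) hAp.le).1 hper
    have hRq : q₁ + 6 ≤ R ^ 2 := by
      refine le_of_mul_le_mul_left ?_ (show 0 < 4 * Real.pi by positivity)
      rw [hRA]; exact hA
    -- Of the `8π` of area saved, `4π` pays for the horizon and the rest absorbs the deviation from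
    -- hyperbolic space.
    set S := √(R ^ 2 - 2) with hS
    have hS2 : S ^ 2 = R ^ 2 - 2 := Real.sq_sqrt (by linarith)
    have hS' : 2 ≤ S := Real.le_sqrt_of_sq_le (by linarith)
    have hV := hdef R S hS' hR.le (by linarith) (by linarith)
    obtain ⟨Ω, hΩ, hΩv, hΩp⟩ := AdS.exists_competitor hm hq₁ (by linarith : 0 ≤ S)
      (integral_nonneg fun x => ((AdS.perturbation hq₁).dens_pos x).le) hV.le
    have hvol : AdS.extVolume (ball 0 1) (AdS.perturbation hq₁).metric Ω
        = AdS.extVolume (ball 0 1) (AdS.perturbation hq₁).metric (closedBall 0 R) := by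
      rw [hΩv, AdS.extVolume, AdS.RadialProfile.vol_eq_ofReal_setIntegral _
        (measurableSet_closedBall.diff measurableSet_ball) (isCompact_closedBall _ _) sdiff_subset]
    rw [AdS.RadialProfile.perimeter_closedBall _ hR] at hiso
    have hle : AdS.profile (ball 0 1) (AdS.perturbation hq₁).metric
        (AdS.extVolume (ball 0 1) (AdS.perturbation hq₁).metric (closedBall 0 R))
        ≤ AdS.perimeter (AdS.perturbation hq₁).metric Ω := iInf₂_le Ω ⟨hΩ, hvol⟩
    rw [← hiso] at hle
    rw [show S ^ 2 + 2 = R ^ 2 by linarith] at hΩp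
    exact absurd hle (not_le.2 hΩp)
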